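/- **Model.** An instance of an online problem consists of information known from the beginning (possibly none) and of requests $r_1,\dots,r_n$. An online algorithm does not know $n$; it answers each $r_i$ irrevocably with a bit $y_i$ (before $r_{i+1}$ arrives). It is deterministic, and it has access to an infinite binary advice tape that was prepared by an oracle which knows the whole instance: the algorithm may at any time read further bits of the tape sequentially, and $y_i$ depends only on the initial information, on $r_1,\dots,r_i$ and on the advice bits read so far. An infeasible output has cost $\infty$ (minimization) or profit $-\infty$ (maximization); the score of a feasible output is the number of accepted requests. Let $c:\mathbb N\to(1,\infty)$ (a constant is a special case). An algorithm $\mathrm{ALG}$ is *$c(n)$-competitive with additive constant $\alpha\in\mathbb{R}$* if every instance $\sigma$ with $n$ requests satisfies $\mathrm{ALG}(\sigma)\le c(n)\cdot\mathrm{OPT}(\sigma)+\alpha$ (minimization), respectively $\mathrm{OPT}(\sigma)\le c(n)\cdot\mathrm{ALG}(\sigma)+\alpha$ (maximization); it is *strictly $c(n)$-competitive* if this holds with $\alpha=0$. It reads at most $b(n)$ bits of advice if, for each $n$, it reads at most $b(n)$ bits on every instance with exactly $n$ requests. **Problems.** In the vertex-arrival model the vertices of an unknown finite simple graph arrive one by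 one, each together with its edges to the earlier vertices, and each is accepted or rejected. - *Online vertex cover* (min): the accepted vertices must form a vertex cover. - *Online cycle finding* (min): the input graph contains a cycle, and the subgraph induced by the accepted vertices must contain a cycle. - *Online dominating set* (min): the accepted vertices must form a dominating set. - *Online set cover, set-arrival version* (min): a finite universe $U$ is known from the beginning; the requests are sets $A_1,\dots,A_n\subseteq U$ with $\bigcup_i A_i=U$, and the union of the accepted sets must be $U$. - *Online independent set* (max): the accepted vertices must form an independent set. - *Online disjoint path allocation* (max): a path with vertices $v_0,\dots,v_L$ is known from the beginning; the requests are subpaths $(v_i,v_j)$, $i<j$, and no two accepted subpaths may share an edge. **AOC.** Write outputs as bit strings $y\in\{0,1\}^n$, where $1$ means "accept" for minimization problems and "reject" for maximization problems. A problem belongs to the class AOC (asymmetric online covering) if every instance has a feasible output, the score of every output is a natural number or the infeasible value, every feasible output has as its score its number of $1$s (minimization), respectively of $0$s (maximization), and every $y$ for which there is an optimal output $y'$ with $y'_i\le y_i$ for all $i$ is feasible. **Theorem.** Let $\log=\log_2$ and $$B(n,c)=\log\Bigl(1+\frac{(c-1)^{c-1}}{c^{c}}\Bigr)\,n .$$ For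 each of the six problems above the following holds. 1. The problem belongs to AOC. 2. (Sufficient.) There is a constant $K$ such that for every function $c:\mathbb N\to(1,\infty)$ there is a strictly $c(n)$-competitive algorithm that, for every $n$, reads at most $B(n,c(n))+K\log(n+1)$ bits of advice on instances with $n$ requests. 3. (Necessary.) For every $\alpha\in\mathbb R$ there is a constant $K$ such that for every function $c:\mathbb N\to(1,\infty)$, every algorithm that is $c(n)$-competitive with additive constant $\alpha$, and all $n,b\in\mathbb{N}$: if the algorithm reads at most $b$ bits of advice on all instances with $n$ requests, then $b\ge B(n,c(n))-K\log(n+1)$. By 1 and 3 each of the six problems is AOC-complete; by 2 and 3, $B(n,c)\pm O(\log n)$ bits of advice are necessary and sufficient for a competitive ratio $c$, and also for a strict competitive ratio $c$. -/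

import Mathlib

/-- Whether the score of an online problem is a cost or a profit. -/
inductive Goal
  | minimize
  | maximize

/-- An online problem with binary answers. An instance `I` consists of information `init I` that is
known from the beginning and of `length I` requests that arrive one by one; an output is a bit
string with one bit per request, and every output has a score (`⊤` resp. `⊥` for an infeasible
output of a minimization resp. maximization problem). -/
structure OnlineProblem where
  Input : Type
  Init : Type
  Req : Type
  init : Input → Init
  length : Input → ℕ
  request : (I : Input) → Fin (length I) → Req
  goal : Goal
  score : (I : Input) → (Fin (length I) → Bool) → EReal

/-- The number of ones of a bit string. -/
def numOnes {n : ℕ} (y : Fin n → Bool) : ℕ :=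
  (Finset.univ.filter fun i => y i = true).card

/-- The number of zeros of a bit string. -/
def numZeros {n : ℕ} (y : Fin n → Bool) : ℕ :=
  (Finset.univ.filter fun i => y i = false).card

namespace OnlineProblem

/-- The score of an optimal offline solution. -/
noncomputable def opt (P : OnlineProblem) (I : P.Input) : EReal :=
  match P.goal with
  | .minimize => ⨅ y, P.score I y
  | .maximize => ⨆ y, P.score I y

/-- The requests `r_0, …, r_i` of the instance `I`, in order of arrival. -/
def requestsUpTo (P : OnlineProblem) (I : P.Input) (i : Fin (P.length I)) : List P.Req :=
  (List.ofFn (P.request I)).take (i + 1)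

/-- A feasible output is one whose score is a natural number. -/
def Feasible (P : OnlineProblem) (I : P.Input) (y : Fin (P.length I) → Bool) : Prop :=
  ∃ k : ℕ, P.score I y = (k : EReal)

/-- Membership in the class AOC (asymmetric online covering), for problems without a final dummy
request. -/
def InAOC (P : OnlineProblem) : Prop :=
  match P.goal with
  | .minimize => ∀ I : P.Input,
      (∀ y, P.Feasible I y ∨ P.score I y = ⊤) ∧
      (∃ y, P.Feasible I y) ∧
      (∀ y, P.Feasible I y → P.score I y = (numOnes y : EReal)) ∧
      (∀ y y', (∀ z, P.score I y' ≤ P.score I z) → (∀ i, y' i = true → y i = true) →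
        P.Feasible I y)
  | .maximize => ∀ I : P.Input,
      (∀ y, P.Feasible I y ∨ P.score I y = ⊥) ∧
      (∃ y, P.Feasible I y) ∧
      (∀ y, P.Feasible I y → P.score I y = (numZeros y : EReal)) ∧
      (∀ y y', (∀ z, P.score I z ≤ P.score I y') → (∀ i, y' i = true → y i = true) →
        P.Feasible I y)

end OnlineProblem

/-- The first `k` bits of an infinite advice tape. -/
def tapePrefix (φ : ℕ → Bool) (k : ℕ) : List Bool :=
  (List.range k).map φ

/-- A deterministic online algorithm with advice, together with its oracle, in the advice-on-tape
model. `step a rs w` is what the algorithm does when the initial information is `a`, the requests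
received so far are `rs` (the last one is to be answered now) and the advice bits read so far are
`w`: either it reads the next bit of the tape (`none`), or it gives the answer `y` to the current
request (`some y`). `oracle I` is the content of the infinite tape prepared for the instance `I`;
the algorithm itself sees neither `I` nor the number of requests. -/
structure AdviceAlgorithm (P : OnlineProblem) where
  step : P.Init → List P.Req → List Bool → Option Bool
  oracle : P.Input → ℕ → Bool

namespace AdviceAlgorithm

variable {P : OnlineProblem}

/-- The computation on the instance `I`: the output is `y`, and exactly `pos i` bits of the tape
have been read when the first `i` requests have been answered. There is at most one such `y`, and
`pos` is determined up to `P.length I`; there is none if the algorithm keeps reading forever. -/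
structure IsRun (A : AdviceAlgorithm P) (I : P.Input) (pos : ℕ → ℕ)
    (y : Fin (P.length I) → Bool) : Prop where
  start : pos 0 = 0
  mono : ∀ i : Fin (P.length I), pos i ≤ pos (i + 1)
  reading : ∀ (i : Fin (P.length I)) (j : ℕ), pos i ≤ j → j < pos (i + 1) →
    A.step (P.init I) (P.requestsUpTo I i) (tapePrefix (A.oracle I) j) = none
  answer : ∀ i : Fin (P.length I),
    A.step (P.init I) (P.requestsUpTo I i) (tapePrefix (A.oracle I) (pos (i + 1))) = some (y i)

/-- The algorithm is `c(n)`-competitive with additive constant `α`: on each instance it produces an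
output, and the score of that output satisfies the bound with `n` the number of requests. -/
def IsCompetitiveWith (A : AdviceAlgorithm P) (c : ℕ → ℝ) (α : ℝ) : Prop :=
  ∀ I : P.Input, ∃ pos y, A.IsRun I pos y ∧
    match P.goal with
    | .minimize => P.score I y ≤ (c (P.length I) : EReal) * P.opt I + (α : EReal)
    | .maximize => P.opt I ≤ (c (P.length I) : EReal) * P.score I y + (α : EReal)

/-- The algorithm is strictly `c(n)`-competitive. -/
def IsStrictlyCompetitive (A : AdviceAlgorithm P) (c : ℕ → ℝ) : Prop :=
  A.IsCompetitiveWith c 0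

/-- The algorithm reads at most `b` advice bits on every instance with `n` requests. -/
def ReadsAtMost (A : AdviceAlgorithm P) (n b : ℕ) : Prop :=
  ∀ (I : P.Input) (pos : ℕ → ℕ) (y : Fin (P.length I) → Bool),
    P.length I = n → A.IsRun I pos y → pos n ≤ b

end AdviceAlgorithm

/-- `B(n, c) = log₂ (1 + (c - 1)^(c - 1) / c^c) · n`. -/
noncomputable def adviceB (n : ℕ) (c : ℝ) : ℝ :=
  Real.logb 2 (1 + (c - 1) ^ (c - 1) / c ^ c) * n

open Classical in
/-- The cost of a solution with `k` accepted requests. -/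
noncomputable def costOf (feasible : Prop) (k : ℕ) : EReal :=
  if feasible then (k : EReal) else ⊤

open Classical in
/-- The profit of a solution with `k` accepted requests. -/
noncomputable def profitOf (feasible : Prop) (k : ℕ) : EReal :=
  if feasible then (k : EReal) else ⊥

/-- In the vertex-arrival model the vertices `0, …, n - 1` of `G` arrive in this order; the request
for the vertex `i` consists of its neighbours among the vertices that arrived before. -/
def vertexArrival {n : ℕ} (G : SimpleGraph (Fin n)) (i : Fin n) : Set ℕ :=
  {k | ∃ j : Fin n, (j : ℕ) = k ∧ j < i ∧ G.Adj j i}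

/-- Online vertex cover; `true` means that the vertex is accepted. -/
noncomputable def onlineVertexCover : OnlineProblem where
  Input := Σ n : ℕ, SimpleGraph (Fin n)
  Init := Unit
  Req := Set ℕ
  init _ := ()
  length I := I.1
  request I := vertexArrival I.2
  goal := .minimize
  score I y := costOf (I.2.IsVertexCover {v | y v = true}) (numOnes y)

/-- Online cycle finding: the accepted vertices (`true`) must induce a subgraph that contains a
cycle. The input graph is promised to contain a cycle. -/
noncomputable def onlineCycleFinding : OnlineProblem where
  Input := {G : Σ n : ℕ, SimpleGraph (Fin n) // ¬ G.2.IsAcyclic}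
  Init := Unit
  Req := Set ℕ
  init _ := ()
  length I := I.1.1
  request I := vertexArrival I.1.2
  goal := .minimize
  score I y := costOf (¬ (I.1.2.induce {v | y v = true}).IsAcyclic) (numOnes y)

/-- Online dominating set; `true` means that the vertex is accepted. -/
noncomputable def onlineDominatingSet : OnlineProblem where
  Input := Σ n : ℕ, SimpleGraph (Fin n)
  Init := Unit
  Req := Set ℕ
  init _ := ()
  length I := I.1
  request I := vertexArrival I.2
  goal := .minimize
  score I y := costOf (∀ v, y v = true ∨ ∃ u, y u = true ∧ I.2.Adj u v) (numOnes y)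

/-- Online independent set; `false` means that the vertex is accepted. -/
noncomputable def onlineIndependentSet : OnlineProblem where
  Input := Σ n : ℕ, SimpleGraph (Fin n)
  Init := Unit
  Req := Set ℕ
  init _ := ()
  length I := I.1
  request I := vertexArrival I.2
  goal := .maximize
  score I y := profitOf (I.2.IsIndepSet {v | y v = false}) (numZeros y)

/-- An instance of set cover: a finite universe (its elements are named by natural numbers) and `n`
subsets whose union is the universe. -/
structure SetCoverInput where
  ground : Finset ℕ
  n : ℕ
  sets : Fin n → Finset ℕ
  union_eq : Finset.univ.biUnion sets = ground

/-- Online set cover in the set-arrival version; the universe is known from the beginning, and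
`true` means that the set is accepted. -/
noncomputable def onlineSetCover : OnlineProblem where
  Input := SetCoverInput
  Init := Finset ℕ
  Req := Finset ℕ
  init I := I.ground
  length I := I.n
  request I := I.sets
  goal := .minimize
  score I y := costOf
    ((Finset.univ.filter fun i => y i = true).biUnion I.sets = I.ground) (numOnes y)

/-- An instance of disjoint path allocation: a path with the vertices `0, …, L` and `n` subpaths of
it, given by their end points. -/
structure PathInput where
  L : ℕ
  n : ℕ
  path : Fin n → ℕ × ℕ
  lt : ∀ i, (path i).1 < (path i).2
  le : ∀ i, (path i).2 ≤ L

/-- Online disjoint path allocation; the path is known from the beginning, and `false` means that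
the request is accepted. The edge between the vertices `k` and `k + 1` is represented by `k`, so
that the edges of the subpath `(u, v)` are the elements of `Set.Ico u v`. -/
noncomputable def onlineDisjointPathAllocation : OnlineProblem where
  Input := PathInput
  Init := ℕ
  Req := ℕ × ℕ
  init I := I.L
  length I := I.n
  request I := I.path
  goal := .maximize
  score I y := profitOf
    ({i | y i = false}.PairwiseDisjoint fun i => Set.Ico (I.path i).1 (I.path i).2) (numZeros y)

/-! Write q for `adviceRate c` and R = c/(c-1) = 1 + 1/(c-1), so that 1/q = R^c (c-1). The terms of
the expansion of (1 + 1/(c-1))^u peak near the index u/c. Therefore C(u,s) agrees with q^(-s) up to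
a factor polynomial in n when u ≤ n is close to cs (`choose_mul_adviceRate_pow_le_one`,
`one_le_choose_mul_adviceRate_pow`). So the ratio C(n,s)/C(⌊cs⌋,s) is essentially C(n,s) q^s, a term
of (1+q)^n. The largest such term is (1+q)^n up to a factor n+1, and B(n,c) is the logarithm of
(1+q)^n. Both bounds reduce to this ratio.

Sufficient: in an AOC problem every string above an optimal output x is feasible, so it is enough to
name a string y above x with few additional ones. Greedy covering designs give a family of
polynomial size times (1+q)^n that contains such a y for every x (`exists_outputs`). The oracle
writes n in a self-delimiting code, followed by the index of y in the family.

Necessary: each problem has instances indexed by strings x, where a request reveals only earlier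
bits of x and a feasible output has to cover x up to one position (`HardFamily`). With the advice
fixed, the algorithm is a deterministic guesser that learns each bit after guessing it; with k
guessed ones it covers at most C(k,t) strings of weight t (`card_le_choose_of_causal`), exactly as a
single fixed set would. Hence 2^b is at least C(n,t)/C(k,t) up to polynomial factors, and the weight
is chosen from the largest term of (1+q)^n (`exists_choose_adviceB_le`). For maximization the same
ratio appears after passing to complements. -/

/-! ### Binomial coefficients and the rate (c-1)^(c-1)/c^c -/

/-- The quantity `(c - 1)^(c - 1) / c^c` from the definition of `adviceB`. -/
noncomputable def adviceRate (c : ℝ) : ℝ := (c - 1) ^ (c - 1) / c ^ c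

lemma adviceRate_pos {c : ℝ} (hc : 1 < c) : 0 < adviceRate c :=
  div_pos (Real.rpow_pos_of_pos (by linarith) _) (Real.rpow_pos_of_pos (by linarith) _)

/-- Puts the reciprocal of the rate in the form that can be compared with the expansion of (1 +
1/(c-1))^u for u near c * s. -/
lemma adviceRate_mul {c : ℝ} (hc : 1 < c) :
    adviceRate c * ((c / (c - 1)) ^ c * (c - 1)) = 1 := by
  have h1 : 0 < c - 1 := by linarith
  have h2 : 0 < c := by linarith
  have h3 := Real.rpow_pos_of_pos h1 c
  have h4 := Real.rpow_pos_of_pos h2 c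
  rw [adviceRate, Real.div_rpow h2.le h1.le, Real.rpow_sub_one h1.ne']
  field_simp

lemma one_le_div_sub_one {c : ℝ} (hc : 1 < c) : 1 ≤ c / (c - 1) := by
  rw [le_div_iff₀ (by linarith)]; linarith

lemma adviceRate_le_one {c : ℝ} (hc : 1 < c) : adviceRate c ≤ 1 := by
  have h1 : 0 < c - 1 := by linarith
  have h := Real.rpow_le_rpow_of_exponent_le (one_le_div_sub_one hc) hc.le
  rw [Real.rpow_one] at h
  have h2 : 1 ≤ (c / (c - 1)) ^ c * (c - 1) :=
    calc (1 : ℝ) ≤ c / (c - 1) * (c - 1) := by rw [div_mul_cancel₀ _ h1.ne']; exact hc.le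
      _ ≤ _ := by gcongr
  have h3 := adviceRate_mul hc
  have h4 := adviceRate_pos hc
  nlinarith

lemma adviceRate_pow_mul {c : ℝ} (hc : 1 < c) (s : ℕ) :
    adviceRate c ^ s * ((c / (c - 1)) ^ (c * s) * (c - 1) ^ s) = 1 := by
  have h0 : 0 ≤ c / (c - 1) := zero_le_one.trans (one_le_div_sub_one hc)
  rw [Real.rpow_mul h0, Real.rpow_natCast, ← mul_pow, ← mul_pow, adviceRate_mul hc, one_pow]

lemma one_add_inv_sub_one {c : ℝ} (hc : 1 < c) : 1 + (c - 1)⁻¹ = c / (c - 1) := by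
  have h1 : c - 1 ≠ 0 := by linarith
  field_simp; ring

lemma sum_choose_mul_pow (a : ℝ) (n : ℕ) :
    ∑ j ∈ Finset.range (n + 1), (n.choose j : ℝ) * a ^ j = (1 + a) ^ n := by
  rw [add_comm 1 a, add_pow]
  exact Finset.sum_congr rfl fun j _ => by simp [mul_comm]

lemma choose_mul_pow_le {a : ℝ} (ha : 0 ≤ a) (n s : ℕ) :
    (n.choose s : ℝ) * a ^ s ≤ (1 + a) ^ n := by
  rcases le_or_gt s n with h | h
  · rw [← sum_choose_mul_pow]
    exact Finset.single_le_sum (f := fun j => (n.choose j : ℝ) * a ^ j)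
      (fun j _ => by positivity) (Finset.mem_range.2 (by omega))
  · rw [Nat.choose_eq_zero_of_lt h]; simp; positivity

/-- The binomial coefficient `u.choose s` is at most `adviceRate c ^ (-s)` for `u ≤ c * s`. -/
lemma choose_mul_adviceRate_pow_le_one {c : ℝ} (hc : 1 < c) {u s : ℕ} (h : (u : ℝ) ≤ c * s) :
    (u.choose s : ℝ) * adviceRate c ^ s ≤ 1 := by
  have h1 : 0 < c - 1 := by linarith
  have h2 := choose_mul_pow_le (inv_nonneg.2 h1.le) u s
  rw [one_add_inv_sub_one hc, ← Real.rpow_natCast (c / (c - 1))] at h2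
  have h3 := h2.trans (Real.rpow_le_rpow_of_exponent_le (one_le_div_sub_one hc) h)
  rw [inv_pow, ← div_eq_mul_inv, div_le_iff₀ (by positivity)] at h3
  calc _ ≤ (c / (c - 1)) ^ (c * s) * (c - 1) ^ s * adviceRate c ^ s := by
        have := adviceRate_pos hc
        gcongr
    _ = 1 := by rw [mul_comm, adviceRate_pow_mul hc]

lemma choose_succ_mul_cast (u j : ℕ) :
    (u.choose (j + 1) : ℝ) * (j + 1) = u.choose j * (u - j) := by
  have h := Nat.choose_succ_right_eq u j
  rcases le_or_gt j u with h1 | h1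
  · rw [← Nat.cast_sub h1]; exact_mod_cast h
  · simp [Nat.choose_eq_zero_of_lt h1, Nat.choose_eq_zero_of_lt (h1.trans (Nat.lt_succ_self j))]

lemma choose_mul_inv_pow_step {c : ℝ} (hc : 1 < c) (u j : ℕ) :
    (c - 1) * (j + 1) * (u.choose (j + 1) * (c - 1)⁻¹ ^ (j + 1)) =
      (u - j) * (u.choose j * (c - 1)⁻¹ ^ j) := by
  have h1 : c - 1 ≠ 0 := by linarith
  have h := choose_succ_mul_cast u j
  rw [pow_succ]
  calc _ = (u.choose (j + 1) * (j + 1) : ℝ) * (c - 1)⁻¹ ^ j * ((c - 1) * (c - 1)⁻¹) := by ring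
    _ = _ := by rw [h, mul_inv_cancel₀ h1]; ring

/-- The terms of the expansion of `(1 + 1 / (c - 1)) ^ u` are unimodal, and the term with index `s`
is at least half of the largest one if `u` is close to `c * s`. -/
lemma choose_mul_inv_pow_le {c : ℝ} (hc : 1 < c) {u s : ℕ} (hs : 2 ≤ s)
    (h1 : c * (s - 1) < u) (h2 : (u : ℝ) ≤ c * s) (j : ℕ) :
    (u.choose j : ℝ) * (c - 1)⁻¹ ^ j ≤ 2 * (u.choose s * (c - 1)⁻¹ ^ s) := by
  obtain ⟨r, rfl⟩ : ∃ r, s = r + 1 := ⟨s - 1, by omega⟩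
  have hd : 0 < c - 1 := by linarith
  have hr : (1 : ℝ) ≤ r := by exact_mod_cast (by omega : 1 ≤ r)
  push_cast at h1 h2
  set T : ℕ → ℝ := fun j => (u.choose j : ℝ) * (c - 1)⁻¹ ^ j with hT
  have hT0 : ∀ j, 0 ≤ T j := fun j => by positivity
  have hstep : ∀ j : ℕ, (c - 1) * (j + 1) * T (j + 1) = (u - j) * T j :=
    fun j => choose_mul_inv_pow_step hc u j
  have hup : ∀ j : ℕ, j < r → T j ≤ T (j + 1) := by
    intro j hj
    have hj' : (j : ℝ) + 1 ≤ r := by exact_mod_cast hj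
    have h3 : (c - 1) * (j + 1) ≤ u - j := by nlinarith
    have h4 : 0 < (c - 1) * ((j : ℝ) + 1) := by positivity
    have h5 := mul_le_mul_of_nonneg_right h3 (hT0 j)
    rw [← hstep j] at h5
    exact le_of_mul_le_mul_left h5 h4
  have hdown : ∀ j : ℕ, r + 1 ≤ j → T (j + 1) ≤ T j := by
    intro j hj
    have hj' : (r : ℝ) + 1 ≤ j := by exact_mod_cast hj
    have h3 : (u : ℝ) - j ≤ (c - 1) * (j + 1) := by nlinarith
    have h4 : 0 < (c - 1) * ((j : ℝ) + 1) := by positivity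
    have h5 := mul_le_mul_of_nonneg_right h3 (hT0 j)
    rw [← hstep j] at h5
    exact le_of_mul_le_mul_left h5 h4
  -- Here the peak may lie on either side. Since u > c * r, the ratio of the two terms is
  -- (c-1)(r+1)/(u-r) < (r+1)/r, which is at most 2 because r ≥ 1; this is where s ≥ 2 enters.
  have hmid : T r ≤ 2 * T (r + 1) := by
    have h3 : (c - 1) * ((r : ℝ) + 1) ≤ 2 * (u - r) := by nlinarith
    have h4 : 0 < (c - 1) * ((r : ℝ) + 1) := by positivity
    have h5 := mul_le_mul_of_nonneg_right h3 (hT0 r)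
    rw [mul_assoc 2, ← hstep r] at h5
    exact le_of_mul_le_mul_left (by linarith) h4
  rcases le_or_gt j r with h | h
  · refine le_trans ?_ hmid
    suffices ∀ k, j ≤ k → k ≤ r → T j ≤ T k from this r h le_rfl
    intro k hk
    induction k, hk using Nat.le_induction with
    | base => exact fun _ => le_rfl
    | succ k hk ih => exact fun hr => (ih (by omega)).trans (hup k (by omega))
  · have : T j ≤ T (r + 1) := by
      induction j, h using Nat.le_induction with
      | base => exact le_rfl
      | succ k hk ih => exact (hdown k hk).trans ih
    linarith [hT0 (r + 1)]

/-- The expansion of (1+a)^n has n+1 terms, and the largest is at least their average. -/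
lemma exists_choose_mul_pow_ge (a : ℝ) (n : ℕ) :
    ∃ s ≤ n, (1 + a) ^ n ≤ (n + 1) * (n.choose s * a ^ s) := by
  by_contra! h
  have h1 : ∑ j ∈ Finset.range (n + 1), ((n : ℝ) + 1) * (n.choose j * a ^ j) <
      ∑ j ∈ Finset.range (n + 1), (1 + a) ^ n :=
    Finset.sum_lt_sum_of_nonempty ⟨0, by simp⟩
      fun j hj => h j (by have := Finset.mem_range.1 hj; omega)
  rw [← Finset.mul_sum, sum_choose_mul_pow] at h1
  simp at h1

lemma rpow_div_sub_one_le {c : ℝ} (hc : 1 < c) : (c / (c - 1)) ^ (c - 1) ≤ Real.exp 1 := by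
  have hd : 0 < c - 1 := by linarith
  have h0 := one_le_div_sub_one hc
  have h : c / (c - 1) ≤ Real.exp (c - 1)⁻¹ := by
    rw [← one_add_inv_sub_one hc, add_comm]; exact Real.add_one_le_exp _
  calc _ ≤ (Real.exp (c - 1)⁻¹) ^ (c - 1) := Real.rpow_le_rpow (by linarith) h hd.le
    _ = _ := by rw [← Real.exp_mul, inv_mul_cancel₀ hd.ne']

/-- `adviceRate c ^ (-s)` exceeds `u.choose s` by a polynomial factor at most. -/
lemma one_le_choose_mul_adviceRate_pow {c : ℝ} (hc : 1 < c) {n u s : ℕ} (hs : 2 ≤ s) (hsu : s ≤ u)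
    (hun : u ≤ n) (h1 : c * (s - 1) < u) (h2 : (u : ℝ) ≤ c * s) :
    1 ≤ 6 * ((n : ℝ) + 1) ^ 2 * (u.choose s * adviceRate c ^ s) := by
  have hd : 0 < c - 1 := by linarith
  have hR := one_le_div_sub_one hc
  have hq := adviceRate_pow_mul hc s
  have he : Real.exp 1 ≤ 3 := by have := Real.exp_one_lt_d9; linarith
  have hn0 : (0 : ℝ) < n := by exact_mod_cast (by omega : 0 < n)
  have hq0 := adviceRate_pos hc
  have hsn : (s : ℝ) ≤ n := by exact_mod_cast hsu.trans hun
  have hun' : (u : ℝ) ≤ n := by exact_mod_cast hun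
  suffices h : (c / (c - 1)) ^ (c * s) * (c - 1) ^ s ≤ 6 * ((n : ℝ) + 1) ^ 2 * u.choose s by
    calc (1 : ℝ) = (c / (c - 1)) ^ (c * s) * (c - 1) ^ s * adviceRate c ^ s := by
          rw [mul_comm, hq]
      _ ≤ 6 * ((n : ℝ) + 1) ^ 2 * u.choose s * adviceRate c ^ s := by gcongr
      _ = _ := by ring
  -- If c is not too close to 1, then R ≤ n+1 and the peak argument applies: u+1 terms, each at most
  -- twice the one with index s, and a remaining power of R with exponent below c. Otherwise both
  -- c^s and R^((c-1)s) are so small that C(u,s) ≥ 1 suffices.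
  rcases le_or_gt 1 (n * (c - 1)) with hcn | hcn
  · have hsum : (c / (c - 1)) ^ u ≤ (u + 1) * (2 * (u.choose s * (c - 1)⁻¹ ^ s)) := by
      rw [← one_add_inv_sub_one hc, ← sum_choose_mul_pow]
      refine (Finset.sum_le_card_nsmul _ _ _
        fun j _ => choose_mul_inv_pow_le hc hs h1 h2 j).trans (by simp)
    have hrest : (c / (c - 1)) ^ (c * s - u) ≤ 3 * (n + 1) := by
      calc _ ≤ (c / (c - 1)) ^ ((c - 1) + 1) :=
            Real.rpow_le_rpow_of_exponent_le hR (by linarith)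
        _ = (c / (c - 1)) ^ (c - 1) * (c / (c - 1)) := Real.rpow_add_one (by linarith) _
        _ ≤ 3 * (n + 1) := by
          gcongr
          · exact (rpow_div_sub_one_le hc).trans he
          · rw [← one_add_inv_sub_one hc, add_comm]
            gcongr
            rw [inv_le_iff_one_le_mul₀ hd]; exact hcn
    calc (c / (c - 1)) ^ (c * s) * (c - 1) ^ s
        = (c / (c - 1)) ^ u * (c / (c - 1)) ^ (c * s - u) * (c - 1) ^ s := by
          rw [← Real.rpow_natCast _ u, ← Real.rpow_add (by linarith)]; congr 2; ring
      _ ≤ ((n + 1) * (2 * (u.choose s * (c - 1)⁻¹ ^ s))) * (3 * (n + 1)) * (c - 1) ^ s := by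
          gcongr
          exact hsum.trans (by gcongr)
      _ = 6 * ((n : ℝ) + 1) ^ 2 * u.choose s * ((c - 1)⁻¹ * (c - 1)) ^ s := by
          rw [mul_pow]; ring
      _ = _ := by rw [inv_mul_cancel₀ hd.ne']; simp
  · have hC : (1 : ℝ) ≤ u.choose s := by exact_mod_cast Nat.choose_pos hsu
    have hcs : c ^ s ≤ 3 := by
      calc c ^ s ≤ (Real.exp (c - 1)) ^ s := by
            gcongr; have := Real.add_one_le_exp (c - 1); linarith
        _ = Real.exp (s * (c - 1)) := by rw [← Real.exp_nat_mul]
        _ ≤ Real.exp 1 := by apply Real.exp_le_exp.2; nlinarith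
        _ ≤ 3 := he
    have hR' : (c / (c - 1)) ^ ((c - 1) * s) ≤ n + 1 := by
      calc (c / (c - 1)) ^ ((c - 1) * s) ≤ (1 + (c - 1)⁻¹) ^ (n * (c - 1)) := by
            rw [one_add_inv_sub_one hc]
            apply Real.rpow_le_rpow_of_exponent_le hR
            rw [mul_comm]; gcongr
        _ ≤ 1 + n * (c - 1) * (c - 1)⁻¹ :=
            -- Bernoulli's inequality for the exponent n(c-1), which is below 1 in this case.
            rpow_one_add_le_one_add_mul_self (by linarith [inv_pos.2 hd]) (by positivity) hcn.le
        _ = n + 1 := by field_simp; ring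
    calc (c / (c - 1)) ^ (c * s) * (c - 1) ^ s
        = (c / (c - 1)) ^ ((c - 1) * s) * ((c / (c - 1)) ^ s * (c - 1) ^ s) := by
          rw [← mul_assoc]
          congr 1
          rw [← Real.rpow_natCast _ s, ← Real.rpow_add (by linarith)]; congr 1; ring
      _ = (c / (c - 1)) ^ ((c - 1) * s) * c ^ s := by
          rw [← mul_pow, div_mul_cancel₀ _ hd.ne']
      _ ≤ (n + 1) * 3 := by gcongr
      _ ≤ 6 * ((n : ℝ) + 1) ^ 2 * 1 := by nlinarith
      _ ≤ _ := by gcongr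

/-- The ratio that bounds the size of covering designs with parameters close to `c`. -/
lemma choose_le_mul_choose {c : ℝ} (hc : 1 < c) {n u s : ℕ} (hsu : s ≤ u) (hun : u ≤ n)
    (h1 : c * (s - 1) < u) (h2 : (u : ℝ) ≤ c * s) :
    (n.choose s : ℝ) ≤ 6 * ((n : ℝ) + 1) ^ 2 * (1 + adviceRate c) ^ n * u.choose s := by
  have hq := adviceRate_pos hc
  rcases le_or_gt 2 s with hs | hs
  · have h := choose_mul_pow_le hq.le n s
    have h3 := one_le_choose_mul_adviceRate_pow hc hs hsu hun h1 h2
    calc (n.choose s : ℝ) = n.choose s * 1 := by ring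
      _ ≤ n.choose s * (6 * ((n : ℝ) + 1) ^ 2 * (u.choose s * adviceRate c ^ s)) := by gcongr
      _ = 6 * ((n : ℝ) + 1) ^ 2 * (n.choose s * adviceRate c ^ s) * u.choose s := by ring
      _ ≤ _ := by gcongr
  · have hC : (1 : ℝ) ≤ u.choose s := by exact_mod_cast Nat.choose_pos hsu
    have hp : (1 : ℝ) ≤ (1 + adviceRate c) ^ n := one_le_pow₀ (by linarith)
    calc (n.choose s : ℝ) ≤ n + 1 := by
          interval_cases s <;> simp
      _ ≤ 6 * ((n : ℝ) + 1) ^ 2 * 1 * 1 := by nlinarith [Nat.cast_nonneg (α := ℝ) n]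
      _ ≤ _ := by gcongr

/-! ### Covering designs -/

lemma numOnes_add_numZeros {n : ℕ} (y : Fin n → Bool) : numOnes y + numZeros y = n := by
  have h := Finset.card_filter_add_card_filter_not (s := (Finset.univ : Finset (Fin n)))
    (fun i => y i = true)
  simpa [numOnes, numZeros] using h

lemma numOnes_le {n : ℕ} (y : Fin n → Bool) : numOnes y ≤ n := by
  have := numOnes_add_numZeros y; omega

/-- A greedy choice leaves a fraction of at most `(1 - ρ) ^ m` uncovered after `m` rounds. -/
lemma exists_greedy_cover {X Y : Type*} (A : Finset X) (B : Finset Y) (R : X → Y → Prop)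
    [∀ x, DecidablePred (R x)] [DecidableEq Y] (hB : B.Nonempty) {ρ : ℝ} (hρ : ρ ≤ 1)
    (h : ∀ x ∈ A, ρ * B.card ≤ (B.filter (R x)).card) (m : ℕ) :
    ∃ S ⊆ B, S.card ≤ m ∧ ∃ U ⊆ A, (U.card : ℝ) ≤ A.card * (1 - ρ) ^ m ∧
      ∀ x ∈ A, x ∉ U → ∃ y ∈ S, R x y := by
  induction m with
  | zero => exact ⟨∅, by simp, by simp, A, subset_rfl, by simp, fun x h h' => absurd h h'⟩
  | succ m ih =>
    obtain ⟨S, hSB, hS, U, hUA, hU, hcov⟩ := ih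
    -- Double counting of the related pairs in U × B: on average an element of B is related to at
    -- least a fraction ρ of the uncovered set U, so some element is.
    have hdc : ∑ y ∈ B, ((U.filter fun x => R x y).card : ℝ) =
        ∑ x ∈ U, ((B.filter (R x)).card : ℝ) := by
      exact_mod_cast (Finset.sum_card_bipartiteAbove_eq_sum_card_bipartiteBelow
        (s := U) (t := B) R).symm
    have hsum : ∑ _y ∈ B, ρ * (U.card : ℝ) ≤ ∑ y ∈ B, ((U.filter fun x => R x y).card : ℝ) := by
      rw [hdc]
      calc ∑ _y ∈ B, ρ * (U.card : ℝ) = ∑ _x ∈ U, ρ * (B.card : ℝ) := by simp; ring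
        _ ≤ _ := Finset.sum_le_sum fun x hx => h x (hUA hx)
    obtain ⟨y, hyB, hy⟩ := Finset.exists_le_of_sum_le hB hsum
    have hsplit := Finset.card_filter_add_card_filter_not (s := U) (fun x => R x y)
    have hsplit' : ((U.filter fun x => R x y).card : ℝ) + (U.filter fun x => ¬ R x y).card =
        U.card := by exact_mod_cast hsplit
    refine ⟨insert y S, Finset.insert_subset hyB hSB, (Finset.card_insert_le _ _).trans
      (by omega), U.filter fun x => ¬ R x y, (Finset.filter_subset _ _).trans hUA, ?_, ?_⟩
    · calc ((U.filter fun x => ¬ R x y).card : ℝ) ≤ U.card * (1 - ρ) := by linarith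
        _ ≤ A.card * (1 - ρ) ^ m * (1 - ρ) := by
          gcongr
        _ = _ := by ring
    · intro x hx hxU
      by_cases hxU' : x ∈ U
      · refine ⟨y, Finset.mem_insert_self _ _, ?_⟩
        by_contra hno
        exact hxU (Finset.mem_filter.2 ⟨hxU', hno⟩)
      · obtain ⟨z, hz, hR⟩ := hcov x hx hxU'
        exact ⟨z, Finset.mem_insert_of_mem hz, hR⟩

lemma choose_le_card_supersets {n t k : ℕ} (x : Finset (Fin n)) (hx : x.card = t) (htk : t ≤ k) :
    (n - t).choose (k - t) ≤
      ((Finset.powersetCard k (Finset.univ : Finset (Fin n))).filter fun y => x ⊆ y).card := by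
  have h : (Finset.powersetCard (k - t) (xᶜ)).card = (n - t).choose (k - t) := by
    rw [Finset.card_powersetCard, Finset.card_compl, Fintype.card_fin, hx]
  rw [← h]
  apply Finset.card_le_card_of_injOn (fun z => x ∪ z)
  · intro z hz
    obtain ⟨hz1, hz2⟩ := Finset.mem_powersetCard.1 hz
    have hd : Disjoint x z := Finset.disjoint_of_subset_right hz1 disjoint_compl_right
    simp only [Finset.coe_filter, Finset.mem_powersetCard, Set.mem_ofPred_eq]
    refine ⟨⟨Finset.subset_univ _, ?_⟩, Finset.subset_union_left⟩
    rw [Finset.card_union_of_disjoint hd, hx, hz2]; omega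
  · intro z hz z' hz' he
    have hz1 := (Finset.mem_powersetCard.1 hz).1
    have hz1' := (Finset.mem_powersetCard.1 hz').1
    have hd : Disjoint x z := Finset.disjoint_of_subset_right hz1 disjoint_compl_right
    have hd' : Disjoint x z' := Finset.disjoint_of_subset_right hz1' disjoint_compl_right
    rw [← Finset.union_sdiff_cancel_left hd, ← Finset.union_sdiff_cancel_left hd']
    exact congrArg (· \ x) he

/-- Covering designs of almost optimal size. -/
lemma exists_covering_design {n t k : ℕ} (hn : 1 ≤ n) (htk : t ≤ k) (hkn : k ≤ n) {M : ℝ}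
    (hM : (n.choose t : ℝ) ≤ M * k.choose t) :
    ∃ S : Finset (Finset (Fin n)), (S.card : ℝ) ≤ (n + 1) * M ∧ (∀ y ∈ S, y.card = k) ∧
      ∀ x : Finset (Fin n), x.card = t → ∃ y ∈ S, x ⊆ y := by
  classical
  have hnt : (0 : ℝ) < n.choose t := by exact_mod_cast Nat.choose_pos (htk.trans hkn)
  have hkt : (0 : ℝ) < k.choose t := by exact_mod_cast Nat.choose_pos htk
  have hnk : (0 : ℝ) < n.choose k := by exact_mod_cast Nat.choose_pos hkn
  -- The proportion of the k-sets that contain a given t-set.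
  set ρ : ℝ := k.choose t / n.choose t with hρ
  have hρ0 : 0 < ρ := by positivity
  have hρ1 : ρ ≤ 1 := by
    rw [hρ, div_le_one hnt]; exact_mod_cast Nat.choose_le_choose t hkn
  have hn1 : (1 : ℝ) ≤ n := by exact_mod_cast hn
  set A := Finset.powersetCard t (Finset.univ : Finset (Fin n)) with hA
  set B := Finset.powersetCard k (Finset.univ : Finset (Fin n)) with hB
  have hAc : A.card = n.choose t := by simp [hA]
  have hBc : B.card = n.choose k := by simp [hB]
  have hBne : B.Nonempty := by
    rw [← Finset.card_pos, hBc]; exact Nat.choose_pos hkn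
  have hdeg : ∀ x ∈ A, ρ * B.card ≤ (B.filter fun y => x ⊆ y).card := by
    intro x hx
    have h1 := choose_le_card_supersets x (Finset.mem_powersetCard.1 hx).2 htk
    have h2 : (n.choose k : ℝ) * k.choose t = n.choose t * (n - t).choose (k - t) := by
      exact_mod_cast Nat.choose_mul htk
    have h3 : ρ * B.card = (n - t).choose (k - t) := by
      rw [hBc, hρ, div_mul_eq_mul_div, div_eq_iff hnt.ne']; linarith
    rw [h3]; exact_mod_cast h1
  -- After n/ρ rounds the uncovered fraction is at most e^(-n). There are at most 2^n sets to cover,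
  -- so fewer than one, hence none, remains.
  obtain ⟨S, hSB, hSm, U, -, hU, hcov⟩ := exists_greedy_cover A B (fun x y => x ⊆ y) hBne hρ1 hdeg
    ⌈n / ρ⌉₊
  refine ⟨S, ?_, fun y hy => (Finset.mem_powersetCard.1 (hSB hy)).2, ?_⟩
  · have h1 : (⌈n / ρ⌉₊ : ℝ) < n / ρ + 1 := Nat.ceil_lt_add_one (by positivity)
    have h2 : (S.card : ℝ) ≤ ⌈n / ρ⌉₊ := by exact_mod_cast hSm
    have h3 : 1 ≤ ρ⁻¹ := (one_le_inv₀ hρ0).2 hρ1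
    have h4 : ρ⁻¹ ≤ M := by
      rw [hρ, inv_div, div_le_iff₀ hkt]; exact hM
    calc (S.card : ℝ) ≤ n * ρ⁻¹ + 1 := by rw [← div_eq_mul_inv]; linarith
      _ ≤ (n + 1) * ρ⁻¹ := by linarith
      _ ≤ _ := by gcongr
  · have hlt : (A.card : ℝ) * (1 - ρ) ^ ⌈n / ρ⌉₊ < 1 := by
      have h1 : (n : ℝ) ≤ ρ * ⌈n / ρ⌉₊ := by
        have := Nat.le_ceil (n / ρ)
        rw [div_le_iff₀ hρ0] at this; linarith
      have h2 : (1 - ρ) ^ ⌈n / ρ⌉₊ ≤ Real.exp (-n) := by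
        calc (1 - ρ) ^ ⌈n / ρ⌉₊ ≤ (Real.exp (-ρ)) ^ ⌈n / ρ⌉₊ := by
              have := Real.add_one_le_exp (-ρ)
              exact pow_le_pow_left₀ (by linarith) (by linarith) _
          _ = Real.exp (⌈n / ρ⌉₊ * -ρ) := by rw [← Real.exp_nat_mul]
          _ ≤ _ := Real.exp_le_exp.2 (by linarith)
      have h3 : (A.card : ℝ) ≤ 2 ^ n := by
        rw [hAc]; exact_mod_cast Nat.choose_le_two_pow n t
      have he : 2 * Real.exp (-1) < 1 := by
        rw [Real.exp_neg, ← div_eq_mul_inv, div_lt_one (Real.exp_pos 1)]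
        have := Real.exp_one_gt_d9; linarith
      calc (A.card : ℝ) * (1 - ρ) ^ ⌈n / ρ⌉₊ ≤ 2 ^ n * Real.exp (-n) := by
            have : 0 ≤ 1 - ρ := by linarith
            gcongr
        _ = (2 * Real.exp (-1)) ^ n := by rw [mul_pow, ← Real.exp_nat_mul]; simp
        _ < 1 := pow_lt_one₀ (by positivity) he (by omega)
    have h0 := lt_of_le_of_lt hU hlt
    have h1 := Finset.card_eq_zero.1 (Nat.cast_lt_one.1 h0)
    exact fun x hx => hcov x (Finset.mem_powersetCard.2 ⟨Finset.subset_univ _, hx⟩) (by simp [h1])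

/-- Uniting the designs for all n+1 weights t costs a second factor n+1 and yields one family that
serves every x. -/
lemma exists_covering_outputs {n : ℕ} (hn : 1 ≤ n) (k : ℕ → ℕ) {M : ℝ}
    (h : ∀ t ≤ n, t ≤ k t ∧ k t ≤ n ∧ (n.choose t : ℝ) ≤ M * (k t).choose t) :
    ∃ F : Finset (Fin n → Bool), (F.card : ℝ) ≤ (n + 1) ^ 2 * M ∧
      ∀ x : Fin n → Bool, ∃ y ∈ F, (∀ i, x i = true → y i = true) ∧
        numOnes y = k (numOnes x) := by
  classical
  have hex : ∀ t : ℕ, ∃ S : Finset (Finset (Fin n)), t ≤ n → (S.card : ℝ) ≤ (n + 1) * M ∧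
      (∀ y ∈ S, y.card = k t) ∧ ∀ x : Finset (Fin n), x.card = t → ∃ y ∈ S, x ⊆ y := by
    intro t
    by_cases ht : t ≤ n
    · obtain ⟨S, hS⟩ := exists_covering_design hn (h t ht).1 (h t ht).2.1 (h t ht).2.2
      exact ⟨S, fun _ => hS⟩
    · exact ⟨∅, fun h => absurd h ht⟩
  choose S hS using hex
  refine ⟨((Finset.range (n + 1)).biUnion S).image fun s i => decide (i ∈ s), ?_, ?_⟩
  · calc ((((Finset.range (n + 1)).biUnion S).image fun s i => decide (i ∈ s)).card : ℝ)
        ≤ ∑ t ∈ Finset.range (n + 1), ((S t).card : ℝ) := by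
          exact_mod_cast Finset.card_image_le.trans Finset.card_biUnion_le
      _ ≤ ∑ _t ∈ Finset.range (n + 1), (n + 1) * M :=
          Finset.sum_le_sum fun t ht => (hS t (by have := Finset.mem_range.1 ht; omega)).1
      _ = _ := by simp; ring
  · intro x
    obtain ⟨-, hk, hc⟩ := hS (numOnes x) (numOnes_le x)
    obtain ⟨s, hs, hxs⟩ := hc (Finset.univ.filter fun i => x i = true) rfl
    refine ⟨fun i => decide (i ∈ s), Finset.mem_image_of_mem _ (Finset.mem_biUnion.2
      ⟨numOnes x, Finset.mem_range.2 (Nat.lt_succ_of_le (numOnes_le x)), hs⟩), ?_, ?_⟩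
    · intro i hi
      simpa using hxs (by simpa using hi)
    · rw [← hk s hs]; simp [numOnes]

lemma exists_outputs_numOnes {c : ℝ} (hc : 1 < c) (n : ℕ) :
    ∃ F : Finset (Fin n → Bool), (F.card : ℝ) ≤ 6 * (n + 1) ^ 4 * (1 + adviceRate c) ^ n ∧
      ∀ x : Fin n → Bool, ∃ y ∈ F, (∀ i, x i = true → y i = true) ∧
        (numOnes y : ℝ) ≤ c * numOnes x := by
  rcases Nat.eq_zero_or_pos n with rfl | hn
  · exact ⟨Finset.univ, by norm_num, fun x => ⟨x, Finset.mem_univ _, fun _ h => h,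
      le_mul_of_one_le_left (Nat.cast_nonneg _) hc.le⟩⟩
  have hq := adviceRate_pos hc
  obtain ⟨F, hF, hcov⟩ := exists_covering_outputs hn (fun t => min ⌊c * t⌋₊ n)
    (M := 6 * ((n : ℝ) + 1) ^ 2 * (1 + adviceRate c) ^ n) (by
      intro t ht
      have h0 : 0 ≤ c * t := by positivity
      have hfl := Nat.floor_le h0
      have hfl' := Nat.lt_floor_add_one (c * t)
      have htf : t ≤ ⌊c * t⌋₊ := Nat.le_floor (by nlinarith [Nat.cast_nonneg (α := ℝ) t])
      refine ⟨le_min htf ht, min_le_right _ _, ?_⟩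
      rcases le_or_gt ⌊c * t⌋₊ n with hle | hlt
      · rw [min_eq_left hle]
        exact choose_le_mul_choose hc htf hle (by linarith) hfl
      -- When c * t exceeds n, accepting everything is good enough and the ratio of binomials is 1.
      · rw [min_eq_right hlt.le]
        have hp : (1 : ℝ) ≤ (1 + adviceRate c) ^ n := one_le_pow₀ (by linarith)
        have h1 : (1 : ℝ) ≤ 6 * ((n : ℝ) + 1) ^ 2 := by nlinarith [Nat.cast_nonneg (α := ℝ) n]
        exact le_mul_of_one_le_left (by positivity) (one_le_mul_of_one_le_of_one_le h1 hp))
  refine ⟨F, hF.trans_eq (by ring), fun x => ?_⟩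
  obtain ⟨y, hy, hxy, hk⟩ := hcov x
  refine ⟨y, hy, hxy, ?_⟩
  rw [hk]
  exact (Nat.cast_le.2 (min_le_left _ _)).trans (Nat.floor_le (by positivity))

/-- If x has u zeros, then y has to keep s = ⌈u/c⌉ of them. Counting pairs of nested zero sets turns
the required ratio C(n,t)/C(n-s,t) into C(n,s)/C(u,s), so the estimate for minimization applies. -/
lemma exists_outputs_numZeros {c : ℝ} (hc : 1 < c) (n : ℕ) :
    ∃ F : Finset (Fin n → Bool), (F.card : ℝ) ≤ 6 * (n + 1) ^ 4 * (1 + adviceRate c) ^ n ∧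
      ∀ x : Fin n → Bool, ∃ y ∈ F, (∀ i, x i = true → y i = true) ∧
        (numZeros x : ℝ) ≤ c * numZeros y := by
  rcases Nat.eq_zero_or_pos n with rfl | hn
  · exact ⟨Finset.univ, by norm_num, fun x => ⟨x, Finset.mem_univ _, fun _ h => h,
      le_mul_of_one_le_left (Nat.cast_nonneg _) hc.le⟩⟩
  have hq := adviceRate_pos hc
  have hc0 : 0 < c := by linarith
  have hceil : ∀ u : ℕ, ⌈u / c⌉₊ ≤ u := fun u =>
    Nat.ceil_le.2 (div_le_self (Nat.cast_nonneg u) hc.le)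
  obtain ⟨F, hF, hcov⟩ := exists_covering_outputs hn (fun t => n - ⌈((n - t : ℕ) : ℝ) / c⌉₊)
    (M := 6 * ((n : ℝ) + 1) ^ 2 * (1 + adviceRate c) ^ n) (by
      intro t ht
      obtain ⟨u, hu⟩ : ∃ u, n - t = u := ⟨_, rfl⟩
      simp only [hu]
      obtain ⟨s, hs⟩ : ∃ s, ⌈(u : ℝ) / c⌉₊ = s := ⟨_, rfl⟩
      have hsu : s ≤ u := hs ▸ hceil u
      have h1 : (u : ℝ) / c ≤ s := hs ▸ Nat.le_ceil _
      have h2 : (s : ℝ) < u / c + 1 := hs ▸ Nat.ceil_lt_add_one (by positivity)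
      rw [hs]
      rw [div_le_iff₀ hc0] at h1
      rw [← sub_lt_iff_lt_add, lt_div_iff₀ hc0] at h2
      refine ⟨by omega, by omega, ?_⟩
      have h3 := choose_le_mul_choose hc hsu (by omega : u ≤ n) (by linarith) (by linarith)
      have h4 : (n.choose t : ℝ) * u.choose s = n.choose s * (n - s).choose t := by
        have ha := Nat.choose_mul (n := n) (k := u) (s := s) hsu
        rw [← Nat.choose_symm (by omega : u ≤ n), show n - u = t by omega,
          ← Nat.choose_symm (by omega : u - s ≤ n - s),
          show n - s - (u - s) = t by omega] at ha
        exact_mod_cast ha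
      have hus : (0 : ℝ) < u.choose s := by exact_mod_cast Nat.choose_pos hsu
      refine le_of_mul_le_mul_right ?_ hus
      rw [h4]
      calc (n.choose s : ℝ) * (n - s).choose t
          ≤ 6 * ((n : ℝ) + 1) ^ 2 * (1 + adviceRate c) ^ n * u.choose s * (n - s).choose t := by
            gcongr
        _ = _ := by ring)
  refine ⟨F, hF.trans_eq (by ring), fun x => ?_⟩
  obtain ⟨y, hy, hxy, hk⟩ := hcov x
  refine ⟨y, hy, hxy, ?_⟩
  have hx := numOnes_add_numZeros x
  have hy' := numOnes_add_numZeros y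
  have hz : n - numOnes x = numZeros x := by omega
  rw [hz] at hk
  have h1 := hceil (numZeros x)
  have h2 : numZeros y = ⌈(numZeros x : ℝ) / c⌉₊ := by omega
  have h3 := Nat.le_ceil ((numZeros x : ℝ) / c)
  rw [div_le_iff₀ hc0] at h3
  rw [h2]; linarith

/-! ### Self-delimiting advice -/

/-- The `k` lowest bits of the number `m`. -/
def lowBits (k m : ℕ) : List Bool := (List.range k).map m.testBit

lemma length_lowBits (k m : ℕ) : (lowBits k m).length = k := by simp [lowBits]

lemma lowBits_injOn {k m m' : ℕ} (hm : m < 2 ^ k) (hm' : m' < 2 ^ k)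
    (h : lowBits k m = lowBits k m') : m = m' := by
  apply Nat.eq_of_testBit_eq
  intro i
  rcases lt_or_ge i k with hi | hi
  · exact List.map_inj_left.1 h i (List.mem_range.2 hi)
  · have hp := Nat.pow_le_pow_right two_pos hi
    rw [Nat.testBit_lt_two_pow (hm.trans_le hp), Nat.testBit_lt_two_pow (hm'.trans_le hp)]

/-- A self-delimiting code word for the pair of `n` and a message of `ℓ n` bits. -/
def codeword (ℓ : ℕ → ℕ) (n m : ℕ) : List Bool :=
  List.replicate n.size true ++ false :: (lowBits n.size n ++ lowBits (ℓ n) m)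

lemma length_codeword (ℓ : ℕ → ℕ) (n m : ℕ) :
    (codeword ℓ n m).length = 2 * n.size + 1 + ℓ n := by
  simp [codeword, length_lowBits]; omega

lemma replicate_prefix {L L' : ℕ} {r r' : List Bool}
    (h : List.replicate L true ++ false :: r <+: List.replicate L' true ++ false :: r') :
    L = L' ∧ r <+: r' := by
  induction L generalizing L' with
  | zero => cases L' <;> simp_all [List.replicate_succ]
  | succ L ih =>
    cases L' with
    | zero => simp [List.replicate_succ] at h
    | succ L' =>
      simp only [List.replicate_succ, List.cons_append, List.cons_prefix_cons, true_and] at h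
      exact ⟨congrArg _ (ih h).1, (ih h).2⟩

lemma append_prefix_append {a a' r r' : List Bool} (hl : a.length = a'.length)
    (h : a ++ r <+: a' ++ r') : a = a' ∧ r <+: r' := by
  obtain ⟨t, ht⟩ := h
  rw [List.append_assoc] at ht
  obtain ⟨h1, h2⟩ := List.append_inj ht hl
  exact ⟨h1, t, h2⟩

/-- A code word can be parsed from the left: the unary block gives the bit length of n, the next
block gives n, and n determines the length of the message. So the algorithm recognizes the end of
the code word without knowing n. -/
lemma codeword_prefix {ℓ : ℕ → ℕ} {n m n' m' : ℕ} (hm : m < 2 ^ ℓ n) (hm' : m' < 2 ^ ℓ n')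
    (h : codeword ℓ n m <+: codeword ℓ n' m') : n = n' ∧ m = m' := by
  obtain ⟨h1, h2⟩ := replicate_prefix h
  obtain ⟨h3, h4⟩ := append_prefix_append (by simp [length_lowBits, h1]) h2
  rw [← h1] at h3
  have hn : n = n' := lowBits_injOn (Nat.lt_size_self n) (h1 ▸ Nat.lt_size_self n') h3
  subst hn
  have h5 := h4.eq_of_length (by simp [length_lowBits])
  exact ⟨rfl, lowBits_injOn hm hm' h5⟩

lemma tapePrefix_getD (w : List Bool) {j : ℕ} (hj : j ≤ w.length) :
    tapePrefix (fun i => w.getD i true) j = w.take j := by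
  apply List.ext_getElem
  · simp [tapePrefix, hj]
  · intro i h1 h2
    have : i < w.length := by simp at h2; omega
    simp [tapePrefix, this]

lemma tapePrefix_prefix (φ : ℕ → Bool) {j k : ℕ} (h : j ≤ k) :
    tapePrefix φ j <+: tapePrefix φ k := by
  have h1 : (List.range k).take j = List.range j := by rw [List.take_range, min_eq_left h]
  rw [tapePrefix, tapePrefix, ← h1]
  exact (List.take_prefix _ _).map _

lemma length_tapePrefix (φ : ℕ → Bool) (k : ℕ) : (tapePrefix φ k).length = k := by
  simp [tapePrefix]

open Classical in
/-- The algorithm that first reads a code word for the number `n` of requests and a message `m`,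
and then answers according to the output `out n m`. -/
noncomputable def codewordAlgorithm (P : OnlineProblem) (ℓ : ℕ → ℕ)
    (out : ∀ n : ℕ, ℕ → Fin n → Bool) (msg : P.Input → ℕ) : AdviceAlgorithm P where
  step _ rs w :=
    if h : ∃ p : ℕ × ℕ, p.2 < 2 ^ ℓ p.1 ∧ codeword ℓ p.1 p.2 = w then
      -- The current request has index `rs.length - 1`. The default `true` is not reached on a tape
      -- whose code word carries the true number of requests.
      some (if hi : rs.length - 1 < h.choose.1 then
        out h.choose.1 h.choose.2 ⟨rs.length - 1, hi⟩ else true)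
    else none
  -- The padding after the code word is never read when the message fits into its ℓ n bits.
  oracle I j := (codeword ℓ (P.length I) (msg I)).getD j true

section

variable {P : OnlineProblem} {ℓ : ℕ → ℕ} {out : ∀ n : ℕ, ℕ → Fin n → Bool} {msg : P.Input → ℕ}

/-- The whole code word is read before the first answer and nothing afterwards. -/
lemma codewordAlgorithm_isRun {I : P.Input} (hI : msg I < 2 ^ ℓ (P.length I)) :
    (codewordAlgorithm P ℓ out msg).IsRun I
      (fun i => if i = 0 then 0 else 2 * (P.length I).size + 1 + ℓ (P.length I))
      (out (P.length I) (msg I)) where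
  start := rfl
  mono i := by
    simp only [Nat.succ_ne_zero, if_false]
    split_ifs <;> omega
  reading i j h1 h2 := by
    by_cases hi : (i : ℕ) = 0
    · simp only [Nat.succ_ne_zero, if_false] at h2
      rw [← length_codeword ℓ _ (msg I)] at h2
      simp only [codewordAlgorithm]
      rw [dif_neg]
      rintro ⟨⟨n, m⟩, hm, hw⟩
      rw [tapePrefix_getD _ h2.le] at hw
      simp only at hw hm
      obtain ⟨rfl, rfl⟩ := codeword_prefix hm hI (hw ▸ List.take_prefix _ _)
      have := congrArg List.length hw
      rw [List.length_take] at this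
      omega
    · simp only [hi, Nat.succ_ne_zero, if_false] at h1 h2
      omega
  answer i := by
    simp only [Nat.succ_ne_zero, if_false]
    rw [← length_codeword ℓ _ (msg I)]
    have htape : tapePrefix ((codewordAlgorithm P ℓ out msg).oracle I)
        (codeword ℓ (P.length I) (msg I)).length = codeword ℓ (P.length I) (msg I) := by
      simp only [codewordAlgorithm]
      rw [tapePrefix_getD _ le_rfl, List.take_length]
    rw [htape]
    have hlen : (P.requestsUpTo I i).length - 1 = i := by
      simp only [OnlineProblem.requestsUpTo, List.length_take, List.length_ofFn]
      omega
    have hex : ∃ p : ℕ × ℕ, p.2 < 2 ^ ℓ p.1 ∧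
        codeword ℓ p.1 p.2 = codeword ℓ (P.length I) (msg I) := ⟨(P.length I, msg I), hI, rfl⟩
    have hch : hex.choose = (P.length I, msg I) := by
      obtain ⟨h1, h2⟩ := hex.choose_spec
      obtain ⟨h3, h4⟩ := codeword_prefix h1 hI ⟨[], by rw [List.append_nil, h2]⟩
      exact Prod.ext h3 h4
    simp only [codewordAlgorithm]
    rw [dif_pos hex]
    have key : ∀ (p : ℕ × ℕ) (k : ℕ), p = (P.length I, msg I) → k = i →
        (if hi : k < p.1 then out p.1 p.2 ⟨k, hi⟩ else true) = out (P.length I) (msg I) i := by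
      rintro p k rfl rfl
      simp
    rw [key _ _ hch hlen]

/-- The bound concerns every possible run. A run that read further would answer at a code word
properly extending the intended one, against prefix-freeness. For n = 0 nothing is read, as it must
be since log(n+1) = 0. -/
lemma codewordAlgorithm_readsAtMost (hmsg : ∀ I, msg I < 2 ^ ℓ (P.length I)) (n : ℕ) :
    (codewordAlgorithm P ℓ out msg).ReadsAtMost n
      (if n = 0 then 0 else 2 * n.size + 1 + ℓ n) := by
  rintro I pos y rfl hrun
  rcases Nat.eq_zero_or_pos (P.length I) with h0 | h0
  · rw [if_pos h0, h0, hrun.start]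
  · rw [if_neg h0.ne']
    by_contra! hlt
    have hans := hrun.answer ⟨P.length I - 1, by omega⟩
    simp only [Nat.sub_add_cancel h0] at hans
    set A := codewordAlgorithm P ℓ out msg with hA
    have hex : ∃ p : ℕ × ℕ, p.2 < 2 ^ ℓ p.1 ∧
        codeword ℓ p.1 p.2 = tapePrefix (A.oracle I) (pos (P.length I)) := by
      by_contra hno
      simp only [hA, codewordAlgorithm] at hans hno
      rw [dif_neg hno] at hans
      cases hans
    obtain ⟨⟨n, m⟩, hm, hw⟩ := hex
    have hp := tapePrefix_prefix (A.oracle I) hlt.le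
    rw [← length_codeword ℓ _ (msg I)] at hp
    have htape : tapePrefix (A.oracle I) (codeword ℓ (P.length I) (msg I)).length =
        codeword ℓ (P.length I) (msg I) := by
      simp only [hA, codewordAlgorithm]
      rw [tapePrefix_getD _ le_rfl, List.take_length]
    rw [htape, ← hw] at hp
    obtain ⟨h1, h2⟩ := codeword_prefix (hmsg I) hm hp
    have h3 := congrArg List.length hw
    simp only at h1 h2
    simp only [length_tapePrefix, length_codeword] at h3
    rw [← h1] at h3
    omega

end

/-! ### The upper bound for all problems in AOC -/

lemma logb_two_succ_ge_one {n : ℕ} (hn : 1 ≤ n) : 1 ≤ Real.logb 2 (n + 1) := by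
  rw [Real.le_logb_iff_rpow_le one_lt_two (by positivity), Real.rpow_one]
  have : (1 : ℝ) ≤ n := by exact_mod_cast hn
  linarith

lemma size_le_logb {n : ℕ} (hn : 1 ≤ n) : (n.size : ℝ) ≤ Real.logb 2 (n + 1) + 1 := by
  have h1 : 2 ^ (n.size - 1) ≤ n := Nat.lt_size.1 (by have := Nat.size_pos.2 hn; omega)
  have h2 : (n.size : ℝ) - 1 = (n.size - 1 : ℕ) := by
    rw [Nat.cast_sub (Nat.size_pos.2 hn)]; simp
  have h3 : ((n.size - 1 : ℕ) : ℝ) ≤ Real.logb 2 (n + 1) := by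
    rw [Real.le_logb_iff_rpow_le one_lt_two (by positivity), Real.rpow_natCast]
    have : ((2 ^ (n.size - 1) : ℕ) : ℝ) ≤ n := by exact_mod_cast h1
    push_cast at this; linarith
  linarith

lemma adviceB_eq (n : ℕ) (c : ℝ) : adviceB n c = n * Real.logb 2 (1 + adviceRate c) :=
  mul_comm _ _

lemma adviceB_nonneg {c : ℝ} (hc : 1 < c) (n : ℕ) : 0 ≤ adviceB n c := by
  rw [adviceB_eq]
  have := adviceRate_pos hc
  have := Real.logb_nonneg one_lt_two (x := 1 + adviceRate c) (by linarith)
  positivity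

lemma exists_message_length {c : ℝ} (hc : 1 < c) {n N : ℕ} (hn : 1 ≤ n)
    (hN : (N : ℝ) ≤ 6 * (n + 1) ^ 4 * (1 + adviceRate c) ^ n) :
    ∃ ℓ : ℕ, N ≤ 2 ^ ℓ ∧ (ℓ : ℝ) ≤ adviceB n c + 8 * Real.logb 2 (n + 1) := by
  have hq := adviceRate_pos hc
  set Z : ℝ := 6 * (n + 1) ^ 4 * (1 + adviceRate c) ^ n with hZ
  have hlog : Real.logb 2 Z =
      Real.logb 2 6 + 4 * Real.logb 2 (n + 1) + n * Real.logb 2 (1 + adviceRate c) := by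
    rw [hZ, Real.logb_mul (by positivity) (by positivity),
      Real.logb_mul (by positivity) (by positivity), Real.logb_pow, Real.logb_pow]
    norm_num
  have h6 : Real.logb 2 6 ≤ 3 := by
    rw [Real.logb_le_iff_le_rpow one_lt_two (by norm_num)]; norm_num
  have h60 : 0 ≤ Real.logb 2 6 := Real.logb_nonneg one_lt_two (by norm_num)
  have h1 := logb_two_succ_ge_one hn
  have hB := adviceB_nonneg hc n
  rw [adviceB_eq] at hB ⊢
  -- The polynomial factor costs log 6 + 4 log(n+1) and rounding costs 1; as log 6 ≤ 3 and log(n+1)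
  -- ≥ 1, this is at most 8 log(n+1).
  refine ⟨⌈Real.logb 2 Z⌉₊, ?_, ?_⟩
  · have h2 := Nat.le_ceil (Real.logb 2 Z)
    rw [Real.logb_le_iff_le_rpow one_lt_two (by positivity), Real.rpow_natCast] at h2
    exact_mod_cast hN.trans h2
  · have h2 := Nat.ceil_lt_add_one (a := Real.logb 2 Z) (by linarith)
    linarith

namespace OnlineProblem

variable {P : OnlineProblem}

/-- This is all that the upper bound uses of AOC: an instance matters only through one optimal
string x, above which every output is scored by its ones. -/
lemma exists_optimal_output_of_minimize (hg : P.goal = .minimize) (h : P.InAOC) (I : P.Input) :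
    ∃ x, P.opt I = (numOnes x : EReal) ∧ ∀ y, (∀ i, x i = true → y i = true) →
      P.score I y = (numOnes y : EReal) := by
  simp only [InAOC, hg] at h
  obtain ⟨h1, ⟨z, k, hz⟩, h3, h4⟩ := h I
  obtain ⟨x, hx⟩ := Finite.exists_min (P.score I)
  have hxf : P.Feasible I x := by
    refine (h1 x).resolve_right fun htop => ?_
    have h5 := hx z
    rw [htop, hz, top_le_iff] at h5
    exact EReal.natCast_ne_top k h5
  refine ⟨x, ?_, fun y hy => h3 y (h4 y x hx hy)⟩
  rw [← h3 x hxf]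
  simp only [opt, hg]
  exact le_antisymm (iInf_le _ x) (le_iInf hx)

lemma exists_optimal_output_of_maximize (hg : P.goal = .maximize) (h : P.InAOC) (I : P.Input) :
    ∃ x, P.opt I = (numZeros x : EReal) ∧ ∀ y, (∀ i, x i = true → y i = true) →
      P.score I y = (numZeros y : EReal) := by
  simp only [InAOC, hg] at h
  obtain ⟨h1, ⟨z, k, hz⟩, h3, h4⟩ := h I
  obtain ⟨x, hx⟩ := Finite.exists_max (P.score I)
  have hxf : P.Feasible I x := by
    refine (h1 x).resolve_right fun hbot => ?_
    have h5 := hx z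
    rw [hbot, hz, le_bot_iff] at h5
    exact EReal.natCast_ne_bot k h5
  refine ⟨x, ?_, fun y hy => h3 y (h4 y x hx hy)⟩
  rw [← h3 x hxf]
  simp only [opt, hg]
  exact le_antisymm (iSup_le hx) (le_iSup (P.score I) x)

/-- The bound that an output of a `c`-competitive algorithm with additive constant `α` meets. -/
def Bounded (P : OnlineProblem) (c α : ℝ) (I : P.Input) (y : Fin (P.length I) → Bool) : Prop :=
  match P.goal with
  | .minimize => P.score I y ≤ (c : EReal) * P.opt I + (α : EReal)
  | .maximize => P.opt I ≤ (c : EReal) * P.score I y + (α : EReal)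

lemma natCast_le_mul_add_iff (c α : ℝ) (a b : ℕ) :
    (a : EReal) ≤ (c : EReal) * (b : EReal) + (α : EReal) ↔ (a : ℝ) ≤ c * b + α := by
  rw [← EReal.coe_coe_eq_natCast, ← EReal.coe_coe_eq_natCast, ← EReal.coe_mul, ← EReal.coe_add,
    EReal.coe_le_coe_iff]

/-- A family of few outputs that contains a good one for every instance. -/
lemma exists_outputs (h : P.InAOC) {c : ℝ} (hc : 1 < c) (n : ℕ) :
    ∃ F : Finset (Fin n → Bool), (F.card : ℝ) ≤ 6 * (n + 1) ^ 4 * (1 + adviceRate c) ^ n ∧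
      ∀ (I : P.Input) (hI : n = P.length I), ∃ y ∈ F, P.Bounded c 0 I (hI ▸ y) := by
  rcases hg : P.goal with _ | _
  · obtain ⟨F, hF, hcov⟩ := exists_outputs_numOnes hc n
    refine ⟨F, hF, ?_⟩
    rintro I rfl
    obtain ⟨x, hopt, hx⟩ := exists_optimal_output_of_minimize hg h I
    obtain ⟨y, hy, hxy, hle⟩ := hcov x
    refine ⟨y, hy, ?_⟩
    simp only [Bounded, hg]
    rw [hx y hxy, hopt, natCast_le_mul_add_iff]
    linarith
  · obtain ⟨F, hF, hcov⟩ := exists_outputs_numZeros hc n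
    refine ⟨F, hF, ?_⟩
    rintro I rfl
    obtain ⟨x, hopt, hx⟩ := exists_optimal_output_of_maximize hg h I
    obtain ⟨y, hy, hxy, hle⟩ := hcov x
    refine ⟨y, hy, ?_⟩
    simp only [Bounded, hg]
    rw [hx y hxy, hopt, natCast_le_mul_add_iff]
    linarith

/-- For every problem in AOC, `adviceB n c + O(log n)` bits suffice. -/
theorem InAOC.exists_strictlyCompetitive (h : P.InAOC) :
    ∃ K : ℝ, ∀ c : ℕ → ℝ, (∀ n, 1 < c n) →
      ∃ (A : AdviceAlgorithm P) (b : ℕ → ℕ),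
        A.IsStrictlyCompetitive c ∧
        (∀ n, A.ReadsAtMost n (b n)) ∧
        ∀ n : ℕ, (b n : ℝ) ≤ adviceB n (c n) + K * Real.logb 2 (n + 1) := by
  -- At most 8 log(n+1) beyond B for the message and 2(log(n+1) + 1) + 1 for the encoding of n.
  refine ⟨13, fun c hc => ?_⟩
  choose F hF hFI using fun n => exists_outputs h (hc n) n
  have hlen : ∀ n : ℕ, ∃ ℓ : ℕ, (F n).card ≤ 2 ^ ℓ ∧
      (1 ≤ n → (ℓ : ℝ) ≤ adviceB n (c n) + 8 * Real.logb 2 (n + 1)) := by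
    intro n
    rcases Nat.eq_zero_or_pos n with rfl | hn
    · exact ⟨(F 0).card, Nat.lt_two_pow_self.le, by simp⟩
    · obtain ⟨ℓ, h1, h2⟩ := exists_message_length (hc n) hn (hF n)
      exact ⟨ℓ, h1, fun _ => h2⟩
  choose ℓ hℓ hℓ' using hlen
  have hmsg : ∀ I : P.Input, ∃ m < 2 ^ ℓ (P.length I),
      P.Bounded (c (P.length I)) 0 I ((F (P.length I)).toList.getD m fun _ => true) := by
    intro I
    obtain ⟨y, hy, hb⟩ := hFI _ I rfl
    obtain ⟨m, hm, rfl⟩ := List.mem_iff_getElem.1 (Finset.mem_toList.2 hy)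
    refine ⟨m, lt_of_lt_of_le (by simpa using hm) (hℓ _), ?_⟩
    rwa [List.getD_eq_getElem _ _ hm]
  choose msg hm hb using hmsg
  refine ⟨codewordAlgorithm P ℓ (fun n m => (F n).toList.getD m fun _ => true) msg, _,
    fun I => ⟨_, _, codewordAlgorithm_isRun (hm I), hb I⟩,
    codewordAlgorithm_readsAtMost hm, fun n => ?_⟩
  rcases Nat.eq_zero_or_pos n with rfl | hn
  · simp [adviceB]
  · rw [if_neg hn.ne']
    push_cast
    linarith [size_le_logb hn, hℓ' n hn, logb_two_succ_ge_one hn]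

end OnlineProblem

/-! ### Guessing a hidden string -/

lemma numOnes_eq_add_tail {n : ℕ} (y : Fin (n + 1) → Bool) :
    numOnes y = (if y 0 = true then 1 else 0) + numOnes (Fin.tail y) := by
  simp only [numOnes, Finset.card_filter, Fin.sum_univ_succ]
  rfl

lemma card_filter_numOnes (n t : ℕ) :
    ((Finset.univ : Finset (Fin n → Bool)).filter fun x => numOnes x = t).card = n.choose t := by
  have h : (Finset.powersetCard t (Finset.univ : Finset (Fin n))).card = n.choose t := by simp
  rw [← h]
  refine Finset.card_bij' (fun x _ => Finset.univ.filter fun i => x i = true)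
    (fun s _ i => decide (i ∈ s)) ?_ ?_ ?_ ?_
  · intro x hx
    exact Finset.mem_powersetCard.2 ⟨Finset.subset_univ _, (Finset.mem_filter.1 hx).2⟩
  · intro s hs
    exact Finset.mem_filter.2 ⟨Finset.mem_univ _, by simpa [numOnes] using hs⟩
  · intro x _; ext i; simp
  · intro s _; ext i; simp

/-- A deterministic online strategy that learns the bits of a hidden string one by one, right after
having guessed them, covers at most `k.choose t` strings with `t` ones if it guesses at most `k`
ones. -/
lemma card_le_choose_of_causal {n : ℕ} (t k : ℕ) (S : Finset (Fin n → Bool))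
    (Y : (Fin n → Bool) → Fin n → Bool)
    (hY : ∀ x ∈ S, ∀ x' ∈ S, ∀ i, (∀ j < i, x j = x' j) → Y x i = Y x' i)
    (hcov : ∀ x ∈ S, ∀ i, x i = true → Y x i = true)
    (ht : ∀ x ∈ S, numOnes x = t) (hk : ∀ x ∈ S, numOnes (Y x) ≤ k) :
    S.card ≤ k.choose t := by
  induction n generalizing t k with
  | zero =>
    rcases S.eq_empty_or_nonempty with rfl | ⟨x, hx⟩
    · simp
    · have : t = 0 := by rw [← ht x hx]; simp [numOnes]
      subst this
      rw [Nat.choose_zero_right]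
      exact Finset.card_le_one.2 fun _ _ _ _ => Subsingleton.elim _ _
  | succ n ih =>
    rcases S.eq_empty_or_nonempty with rfl | ⟨x₀, hx₀⟩
    · simp
    set β := Y x₀ 0 with hβ
    have hY0 : ∀ x ∈ S, Y x 0 = β := fun x hx =>
      hY x hx x₀ hx₀ 0 fun j hj => absurd hj (Fin.not_lt_zero j)
    have key : ∀ (γ : Bool) (t' k' : ℕ),
        (∀ x ∈ S, x 0 = γ → numOnes (Fin.tail x) = t' ∧ numOnes (Fin.tail (Y x)) ≤ k') →
        (S.filter fun x => x 0 = γ).card ≤ k'.choose t' := by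
      intro γ t' k' h
      have hinj : Set.InjOn Fin.tail ((S.filter fun x => x 0 = γ : Finset _) :
          Set (Fin (n + 1) → Bool)) := by
        intro x hx x' hx' he
        have h1 := (Finset.mem_filter.1 hx).2
        have h2 := (Finset.mem_filter.1 hx').2
        rw [← Fin.cons_self_tail x, ← Fin.cons_self_tail x', h1, h2, he]
      rw [← Finset.card_image_of_injOn hinj]
      have hmem : ∀ z ∈ (S.filter fun x => x 0 = γ).image Fin.tail,
          (Fin.cons γ z : Fin (n + 1) → Bool) ∈ S := by
        intro z hz
        obtain ⟨x, hx, rfl⟩ := Finset.mem_image.1 hz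
        obtain ⟨hx1, hx2⟩ := Finset.mem_filter.1 hx
        rwa [← hx2, Fin.cons_self_tail]
      refine ih t' k' _ (fun z => Fin.tail (Y (Fin.cons γ z))) ?_ ?_ ?_ ?_
      · intro z hz z' hz' i hi
        refine hY _ (hmem z hz) _ (hmem z' hz') i.succ fun j hj => ?_
        refine Fin.cases (by simp) (fun j hj => ?_) j hj
        simpa using hi j (Fin.succ_lt_succ_iff.1 hj)
      · intro z hz i hi
        exact hcov _ (hmem z hz) i.succ (by simpa using hi)
      · intro z hz
        simpa using (h _ (hmem z hz) (by simp)).1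
      · intro z hz
        exact (h _ (hmem z hz) (by simp)).2
    have hsplit : S.card = (S.filter fun x => x 0 = false).card +
        (S.filter fun x => x 0 = true).card := by
      rw [← Finset.card_filter_add_card_filter_not (s := S) (fun x => x 0 = false)]
      simp
    have ht' : ∀ x ∈ S, (if x 0 = true then 1 else 0) + numOnes (Fin.tail x) = t :=
      fun x hx => (numOnes_eq_add_tail x).symm.trans (ht x hx)
    have hk' : ∀ x ∈ S, (if β = true then 1 else 0) + numOnes (Fin.tail (Y x)) ≤ k := by
      intro x hx
      have h1 := hk x hx
      rwa [numOnes_eq_add_tail, hY0 x hx] at h1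
    have hempty : (∀ x ∈ S, x 0 ≠ true) → (S.filter fun x => x 0 = true).card = 0 := by
      intro h
      rw [Finset.card_eq_zero, Finset.filter_eq_empty_iff]
      exact fun x hx => h x hx
    have hfalse : ∀ k', (∀ x ∈ S, numOnes (Fin.tail (Y x)) ≤ k') →
        (S.filter fun x => x 0 = false).card ≤ k'.choose t := by
      intro k' h
      refine key false t k' fun x hx hx0 => ⟨?_, h x hx⟩
      have := ht' x hx
      simpa [hx0] using this
    -- A guessed one uses up one of the k ones whatever the hidden bit is, so the halves of S are
    -- bounded by C(k-1,t) and C(k-1,t-1), and Pascal's rule adds them. A guessed zero excludes a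
    -- hidden one, so only strings starting with zero are left.
    rcases Bool.eq_false_or_eq_true β with hb | hb
    · simp only [hb, if_true] at hk'
      obtain ⟨k, rfl⟩ : ∃ k', k = k' + 1 := ⟨k - 1, by have := hk' x₀ hx₀; omega⟩
      have h1 := hfalse k fun x hx => by have := hk' x hx; omega
      rcases t with _ | t
      · rw [hsplit, hempty fun x hx hx0 => by have := ht' x hx; simp [hx0] at this]
        simpa using h1
      · have h2 := key true t k fun x hx hx0 => by
          have h3 := ht' x hx
          have h4 := hk' x hx
          simp only [hx0, if_true] at h3
          exact ⟨by omega, by omega⟩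
        rw [hsplit, Nat.choose_succ_succ']
        omega
    · rw [hsplit, hempty fun x hx hx0 => by
        have h1 := hcov x hx 0 hx0
        rw [hY0 x hx, hb] at h1
        cases h1]
      simp only [hb] at hk'
      exact hfalse k fun x hx => by simpa using hk' x hx

lemma tapePrefix_congr {φ ψ : ℕ → Bool} {b j : ℕ} (h : ∀ i < b, φ i = ψ i) (hj : j ≤ b) :
    tapePrefix φ j = tapePrefix ψ j :=
  List.map_congr_left fun i hi => h i ((List.mem_range.1 hi).trans_le hj)

namespace AdviceAlgorithm

variable {P : OnlineProblem} {A : AdviceAlgorithm P}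

lemma IsRun.pos_mono {I : P.Input} {pos : ℕ → ℕ} {y : Fin (P.length I) → Bool}
    (h : A.IsRun I pos y) {i : ℕ} (hi : i ≤ P.length I) : pos i ≤ pos (P.length I) := by
  induction hi using Nat.decreasingInduction with
  | self => exact le_rfl
  | of_succ k hk ih => exact (h.mono ⟨k, hk⟩).trans ih

/-- Two runs agree as long as the requests and the advice bits agree. -/
lemma IsRun.answer_congr {I I' : P.Input} {pos pos' : ℕ → ℕ} {y : Fin (P.length I) → Bool}
    {y' : Fin (P.length I') → Bool} (h : A.IsRun I pos y) (h' : A.IsRun I' pos' y') {b m : ℕ}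
    (hm : m < P.length I) (hm' : m < P.length I') (hinit : P.init I = P.init I')
    (hreq : ∀ i (hi : i ≤ m), P.requestsUpTo I ⟨i, hi.trans_lt hm⟩ =
      P.requestsUpTo I' ⟨i, hi.trans_lt hm'⟩)
    (hb : pos (P.length I) ≤ b) (hb' : pos' (P.length I') ≤ b)
    (htape : ∀ j < b, A.oracle I j = A.oracle I' j) : y ⟨m, hm⟩ = y' ⟨m, hm'⟩ := by
  -- If one run read further than the other, then at the same requests and the same advice bits one
  -- would answer and the other would read.
  have hstep : ∀ i, i ≤ m → pos i = pos' i → pos (i + 1) = pos' (i + 1) := by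
    intro i hi heq
    have h1 := (h.pos_mono (i := i + 1) (by omega)).trans hb
    have h1' := (h'.pos_mono (i := i + 1) (by omega)).trans hb'
    rcases lt_trichotomy (pos (i + 1)) (pos' (i + 1)) with hlt | heq' | hlt
    · have h2 := h.answer ⟨i, hi.trans_lt hm⟩
      have h3 := h'.reading ⟨i, hi.trans_lt hm'⟩ (pos (i + 1))
        (heq ▸ h.mono ⟨i, hi.trans_lt hm⟩) hlt
      rw [← hinit, ← hreq i hi, ← tapePrefix_congr htape h1] at h3
      exact absurd (h2.symm.trans h3) (by simp)
    · exact heq'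
    · have h2 := h'.answer ⟨i, hi.trans_lt hm'⟩
      have h3 := h.reading ⟨i, hi.trans_lt hm⟩ (pos' (i + 1))
        (heq ▸ h'.mono ⟨i, hi.trans_lt hm'⟩) hlt
      rw [hinit, hreq i hi, tapePrefix_congr htape h1'] at h3
      exact absurd (h2.symm.trans h3) (by simp)
  have hpos : ∀ i, i ≤ m + 1 → pos i = pos' i := by
    intro i
    induction i with
    | zero => intro _; rw [h.start, h'.start]
    | succ i ih => intro hi; exact hstep i (by omega) (ih (by omega))
  have h2 := h.answer ⟨m, hm⟩
  have h3 := h'.answer ⟨m, hm'⟩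
  simp only at h2 h3
  rw [← hinit, ← hreq m le_rfl, ← hpos (m + 1) le_rfl,
    ← tapePrefix_congr htape ((h.pos_mono (i := m + 1) hm).trans hb), h2] at h3
  exact Option.some.inj h3

end AdviceAlgorithm

/-! ### Hard families and the counting bound -/

/-- For each bit string `x` of length `n` an instance with `n + a` requests such that the request
`i < n` depends only on the earlier bits of `x`, and such that the feasible outputs have to cover
`x`, except possibly at one position. -/
structure HardFamily (P : OnlineProblem) (a : ℕ) where
  inst : (n : ℕ) → (Fin n → Bool) → P.Input
  length_inst : ∀ n x, P.length (inst n x) = n + a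
  init_inst : ∀ n x x', P.init (inst n x) = P.init (inst n x')
  request_inst : ∀ n x x' (i : Fin n), (∀ j < i, x j = x' j) →
    P.request (inst n x) ⟨i, by rw [length_inst]; omega⟩ =
      P.request (inst n x') ⟨i, by rw [length_inst]; omega⟩
  exists_output : ∀ n x, ∃ y, P.Feasible (inst n x) y ∧ numOnes y ≤ numOnes x + a
  covers : ∀ n x y, P.Feasible (inst n x) y → ∃ e : ℕ, ∀ i : Fin n, x i = true → (i : ℕ) ≠ e →
    y ⟨i, by rw [length_inst]; omega⟩ = true

namespace HardFamily

variable {P : OnlineProblem} {a : ℕ} (H : HardFamily P a)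

lemma lt_length (n : ℕ) (x : Fin n → Bool) (i : Fin n) : (i : ℕ) < P.length (H.inst n x) := by
  rw [H.length_inst]; omega

lemma requestsUpTo_congr (n : ℕ) (x x' : Fin n → Bool) (i : Fin n) (h : ∀ j < i, x j = x' j) :
    P.requestsUpTo (H.inst n x) ⟨i, H.lt_length n x i⟩ =
      P.requestsUpTo (H.inst n x') ⟨i, H.lt_length n x' i⟩ := by
  have h1 := H.length_inst n x
  have h2 := H.length_inst n x'
  apply List.ext_getElem
  · simp [OnlineProblem.requestsUpTo, h1, h2]
  · intro k hk hk'
    simp only [OnlineProblem.requestsUpTo, List.length_take, List.length_ofFn, lt_min_iff] at hk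
    simp only [OnlineProblem.requestsUpTo, List.getElem_take, List.getElem_ofFn]
    exact H.request_inst n x x' ⟨k, by omega⟩ fun j hj =>
      h j (hj.trans_le (Fin.mk_le_of_le_val (by simpa using Nat.le_of_lt_succ hk.1)))

lemma numOnes_or_le {n : ℕ} {x : Fin n → Bool} (y : Fin (P.length (H.inst n x)) → Bool) (e : ℕ) :
    numOnes (fun i : Fin n => y ⟨i, H.lt_length n x i⟩ || decide ((i : ℕ) = e)) ≤
      numOnes y + 1 := by
  have h1 : (Finset.univ.filter fun i : Fin n =>
      (y ⟨i, H.lt_length n x i⟩ || decide ((i : ℕ) = e)) = true) ⊆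
      (Finset.univ.filter fun i : Fin n => y ⟨i, H.lt_length n x i⟩ = true) ∪
      (Finset.univ.filter fun i : Fin n => (i : ℕ) = e) := by
    intro i; simp
  refine (Finset.card_le_card h1).trans ((Finset.card_union_le _ _).trans (add_le_add ?_ ?_))
  · apply Finset.card_le_card_of_injOn (fun i => ⟨i, H.lt_length n x i⟩)
    · intro i hi; simpa using hi
    · intro i _ j _ hij
      exact Fin.ext (by simpa using hij)
  · refine Finset.card_le_one.2 fun i hi j hj => Fin.ext ?_
    rw [(Finset.mem_filter.1 hi).2, (Finset.mem_filter.1 hj).2]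

/-- The number of instances for which few advice bits are good. -/
theorem choose_le {A : AdviceAlgorithm P} {n b t k : ℕ} (hb : A.ReadsAtMost (n + a) b)
    (pos : (Fin n → Bool) → ℕ → ℕ) (y : ∀ x, Fin (P.length (H.inst n x)) → Bool)
    (hrun : ∀ x, A.IsRun (H.inst n x) (pos x) (y x))
    (hfeas : ∀ x, numOnes x = t → P.Feasible (H.inst n x) (y x) ∧ numOnes (y x) ≤ k) :
    n.choose t ≤ 2 ^ b * (n + 1) * (k + 1).choose t := by
  have hex : ∀ x, ∃ e : ℕ, numOnes x = t → ∀ i : Fin n, x i = true → (i : ℕ) ≠ e →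
      y x ⟨i, H.lt_length n x i⟩ = true := by
    intro x
    by_cases hx : numOnes x = t
    · obtain ⟨e, he⟩ := H.covers n x (y x) (hfeas x hx).1
      exact ⟨e, fun _ => he⟩
    · exact ⟨0, fun h => absurd h hx⟩
  choose e he using hex
  have hposb : ∀ x, pos x (P.length (H.inst n x)) ≤ b := by
    intro x
    have := hb (H.inst n x) (pos x) (y x) (H.length_inst n x) (hrun x)
    rwa [H.length_inst]
  -- Strings are classified by the first b tape bits and the exceptional position, where n stands
  -- for none. Inside a class the answers form a causal strategy.
  let f : (Fin n → Bool) → (Fin b → Bool) × Fin (n + 1) := fun x =>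
    (fun j => A.oracle (H.inst n x) j, ⟨min (e x) n, by omega⟩)
  rw [← card_filter_numOnes n t]
  have h := Finset.card_le_mul_card_image_of_maps_to
    (s := (Finset.univ : Finset (Fin n → Bool)).filter fun x => numOnes x = t)
    (t := Finset.univ) (f := f) (fun _ _ => Finset.mem_univ _) ((k + 1).choose t) ?_
  · refine h.trans_eq ?_
    simp; ring
  · rintro ⟨w, ε⟩ -
    -- Accepting at the exceptional position ε as well makes the guesses cover x, at the price of
    -- one more one.
    refine card_le_choose_of_causal t (k + 1) _
      (fun x i => y x ⟨i, H.lt_length n x i⟩ || decide ((i : ℕ) = ε)) ?_ ?_ ?_ ?_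
    · intro x hx x' hx' i hi
      have h1 := (Finset.mem_filter.1 hx).2.trans (Finset.mem_filter.1 hx').2.symm
      have h2 := (Prod.ext_iff.1 h1).1
      congr 1
      exact (hrun x).answer_congr (hrun x') (b := b) _ _ (H.init_inst n x x')
        (fun j hj => H.requestsUpTo_congr n x x' ⟨j, by omega⟩ fun l hl =>
          hi l (hl.trans_le (Fin.mk_le_of_le_val hj)))
        (hposb x) (hposb x') fun j hj => congrFun h2 ⟨j, hj⟩
    · intro x hx i hxi
      obtain ⟨hx1, hx2⟩ := Finset.mem_filter.1 hx
      have h2 : min (e x) n = ε := congrArg (fun p => (p.2 : ℕ)) hx2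
      by_cases hie : (i : ℕ) = ε
      · simp [hie]
      · simp [he x (Finset.mem_filter.1 hx1).2 i hxi (by omega)]
    · intro x hx
      exact (Finset.mem_filter.1 (Finset.mem_filter.1 hx).1).2
    · intro x hx
      exact (H.numOnes_or_le (y x) ε).trans (Nat.add_le_add_right
        (hfeas x (Finset.mem_filter.1 (Finset.mem_filter.1 hx).1).2).2 1)

end HardFamily

/-! ### From counting to the lower bound -/

/-- Raising u by one multiplies C(u,s) by (u+1)/(u+1-s) ≤ u+1, so additive constants in the number
of ones cost only polynomial factors. -/
lemma choose_add_le_pow_mul {u s : ℕ} (h : s ≤ u) (D : ℕ) :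
    (u + D).choose s ≤ (u + D) ^ D * u.choose s := by
  induction D with
  | zero => simp
  | succ D ih =>
    have h1 := Nat.choose_mul_succ_eq (u + D) s
    calc (u + D + 1).choose s ≤ (u + D + 1).choose s * (u + D + 1 - s) :=
          Nat.le_mul_of_pos_right _ (by omega)
      _ = (u + D).choose s * (u + D + 1) := h1.symm
      _ ≤ (u + D) ^ D * u.choose s * (u + D + 1) := by gcongr
      _ ≤ (u + D + 1) ^ D * u.choose s * (u + D + 1) := by
        have := Nat.pow_le_pow_left (Nat.le_succ (u + D)) D
        gcongr
      _ = _ := by rw [pow_succ]; ring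

/-- Bounds the loss from discarding the a requests that follow the hidden string. -/
lemma choose_add_add_le (n t a : ℕ) :
    (n + a).choose (t + a) ≤ (n + a + 1) ^ a * n.choose t := by
  induction a with
  | zero => simp
  | succ a ih =>
    have h1 := Nat.add_one_mul_choose_eq (n + a) (t + a)
    calc (n + a + 1).choose (t + a + 1)
        ≤ (n + a + 1).choose (t + a + 1) * (t + a + 1) := Nat.le_mul_of_pos_right _ (by omega)
      _ = (n + a + 1) * (n + a).choose (t + a) := h1.symm
      _ ≤ (n + a + 1) * ((n + a + 1) ^ a * n.choose t) := by gcongr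
      _ = (n + a + 1) ^ (a + 1) * n.choose t := by rw [pow_succ]; ring
      _ ≤ _ := by gcongr; omega

lemma choose_le_choose_add_add (n t a : ℕ) : n.choose t ≤ (n + a).choose (t + a) := by
  induction a with
  | zero => simp
  | succ a ih => exact ih.trans (by rw [← add_assoc, ← add_assoc, Nat.choose_succ_succ]; omega)

/-- A bound for the ratio of binomial coefficients yields a lower bound for the advice. -/
lemma exists_choose_adviceB_le (m D : ℕ) {c : ℝ} (hc : 1 < c) {N : ℕ} (hN : 1 ≤ N) :
    ∃ s ≤ N, ∀ b : ℕ, N.choose s ≤ 2 ^ b * (N + 1) ^ m * (⌊c * s⌋₊ + D).choose s →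
      adviceB N c - (m + 1 + D * (1 + Real.logb 2 (D + 1))) * Real.logb 2 (N + 1) ≤ b := by
  have hq := adviceRate_pos hc
  -- The hard weight is the index of a large term of (1+q)^N.
  obtain ⟨s, hs, hmax⟩ := exists_choose_mul_pow_ge (adviceRate c) N
  refine ⟨s, hs, fun b hb => ?_⟩
  have hfl : (⌊c * s⌋₊ : ℝ) ≤ c * s := Nat.floor_le (by positivity)
  have hsf : s ≤ ⌊c * s⌋₊ := Nat.le_floor (by nlinarith [Nat.cast_nonneg (α := ℝ) s])
  have hone := choose_mul_adviceRate_pow_le_one hc hfl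
  have hmain : (1 + adviceRate c) ^ N ≤
      2 ^ b * ((N : ℝ) + 1) ^ (m + 1) * (((N : ℝ) + 1) * (D + 1)) ^ D := by
    rcases le_or_gt ⌊c * s⌋₊ N with hle | hlt
    · have h1 : ((⌊c * s⌋₊ + D).choose s : ℝ) ≤
          (((N : ℝ) + 1) * (D + 1)) ^ D * (⌊c * s⌋₊).choose s := by
        have h2 : ((⌊c * s⌋₊ + D).choose s : ℝ) ≤
            ((⌊c * s⌋₊ : ℝ) + D) ^ D * (⌊c * s⌋₊).choose s := by
          exact_mod_cast choose_add_le_pow_mul hsf D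
        refine h2.trans ?_
        have h3 : (⌊c * s⌋₊ : ℝ) ≤ N := by exact_mod_cast hle
        gcongr
        nlinarith [Nat.cast_nonneg (α := ℝ) N, Nat.cast_nonneg (α := ℝ) D,
          mul_nonneg (Nat.cast_nonneg (α := ℝ) N) (Nat.cast_nonneg (α := ℝ) D)]
      have hb' : (N.choose s : ℝ) ≤ 2 ^ b * (N + 1) ^ m * (⌊c * s⌋₊ + D).choose s := by
        exact_mod_cast hb
      calc (1 + adviceRate c) ^ N ≤ (N + 1) * (N.choose s * adviceRate c ^ s) := hmax
        _ ≤ (N + 1) * ((2 ^ b * (N + 1) ^ m *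
            ((((N : ℝ) + 1) * (D + 1)) ^ D * (⌊c * s⌋₊).choose s)) * adviceRate c ^ s) := by
          gcongr
          exact hb'.trans (by gcongr)
        _ = 2 ^ b * ((N : ℝ) + 1) ^ (m + 1) * (((N : ℝ) + 1) * (D + 1)) ^ D *
            ((⌊c * s⌋₊).choose s * adviceRate c ^ s) := by ring
        _ ≤ 2 ^ b * ((N : ℝ) + 1) ^ (m + 1) * (((N : ℝ) + 1) * (D + 1)) ^ D * 1 := by gcongr
        _ = _ := mul_one _
    -- If c * s exceeds N, the large term is at most 1, so (1+q)^N ≤ N+1 and the claim holds even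
    -- for b = 0.
    · have h1 : (N.choose s : ℝ) * adviceRate c ^ s ≤ 1 := by
        refine le_trans ?_ hone
        gcongr
      have hN1 : (1 : ℝ) ≤ N + 1 := by linarith [Nat.cast_nonneg (α := ℝ) N]
      have hD1 : (1 : ℝ) ≤ D + 1 := by linarith [Nat.cast_nonneg (α := ℝ) D]
      calc (1 + adviceRate c) ^ N ≤ (N + 1) * (N.choose s * adviceRate c ^ s) := hmax
        _ ≤ (N + 1) * 1 := by gcongr
        _ = 1 * ((N : ℝ) + 1) ^ (0 + 1) * 1 := by ring
        _ ≤ _ := by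
          gcongr
          · exact one_le_pow₀ one_le_two
          · exact Nat.zero_le m
          · exact one_le_pow₀ (one_le_mul_of_one_le_of_one_le hN1 hD1)
  have hlog := Real.logb_le_logb_of_le one_lt_two (by positivity) hmain
  rw [Real.logb_pow, Real.logb_mul (by positivity) (by positivity),
    Real.logb_mul (by positivity) (by positivity), Real.logb_pow, Real.logb_pow, Real.logb_pow,
    Real.logb_mul (by positivity) (by positivity), Real.logb_self_eq_one one_lt_two] at hlog
  rw [adviceB_eq]
  have h1 := logb_two_succ_ge_one hN
  have h2 : 0 ≤ (D : ℝ) * Real.logb 2 (D + 1) :=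
    mul_nonneg (Nat.cast_nonneg D) (Real.logb_nonneg one_lt_two (by simp))
  have h3 := mul_le_mul_of_nonneg_left h1 h2
  push_cast at hlog
  linarith

lemma adviceB_le {c : ℝ} (hc : 1 < c) (n : ℕ) : adviceB n c ≤ n := by
  rw [adviceB_eq]
  have h0 := adviceRate_pos hc
  have h1 := adviceRate_le_one hc
  have : Real.logb 2 (1 + adviceRate c) ≤ 1 := by
    rw [Real.logb_le_iff_le_rpow one_lt_two (by linarith)]; norm_num; linarith
  exact mul_le_of_le_one_right (Nat.cast_nonneg n) this

namespace OnlineProblem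

variable {P : OnlineProblem}

/-- Any feasible z bounds the optimum by a finite number, which excludes the infinite cost of an
infeasible y. -/
lemma Bounded.of_minimize (hg : P.goal = .minimize) (h : P.InAOC) {c α : ℝ} (hc : 1 < c)
    {I : P.Input} {y z : Fin (P.length I) → Bool} (hy : P.Bounded c α I y) (hz : P.Feasible I z) :
    P.Feasible I y ∧ (numOnes y : ℝ) ≤ c * numOnes z + α := by
  simp only [InAOC, hg] at h
  obtain ⟨h1, -, h3, -⟩ := h I
  simp only [Bounded, hg] at hy
  have hopt : P.opt I ≤ (numOnes z : EReal) := by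
    rw [← h3 z hz]
    simp only [opt, hg]
    exact iInf_le _ z
  have hle : P.score I y ≤ (c : EReal) * (numOnes z : EReal) + (α : EReal) := by
    refine hy.trans (add_le_add_left (mul_le_mul_of_nonneg_left hopt ?_) _)
    exact_mod_cast (zero_lt_one.trans hc).le
  have hf : P.Feasible I y := by
    refine (h1 y).resolve_right fun htop => ?_
    rw [htop, ← EReal.coe_coe_eq_natCast, ← EReal.coe_mul, ← EReal.coe_add, top_le_iff] at hle
    exact EReal.coe_ne_top _ hle
  refine ⟨hf, ?_⟩
  rwa [h3 y hf, natCast_le_mul_add_iff] at hle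

lemma Bounded.of_maximize (hg : P.goal = .maximize) (h : P.InAOC) {c α : ℝ} (hc : 1 < c)
    {I : P.Input} {y z : Fin (P.length I) → Bool} (hy : P.Bounded c α I y) (hz : P.Feasible I z) :
    P.Feasible I y ∧ (numZeros z : ℝ) ≤ c * numZeros y + α := by
  simp only [InAOC, hg] at h
  obtain ⟨h1, -, h3, -⟩ := h I
  simp only [Bounded, hg] at hy
  have hopt : (numZeros z : EReal) ≤ P.opt I := by
    rw [← h3 z hz]
    simp only [opt, hg]
    exact le_iSup (P.score I) z
  have hle := hopt.trans hy
  have hf : P.Feasible I y := by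
    refine (h1 y).resolve_right fun hbot => ?_
    rw [hbot, EReal.coe_mul_bot_of_pos (zero_lt_one.trans hc), EReal.bot_add, le_bot_iff] at hle
    exact EReal.natCast_ne_bot _ hle
  refine ⟨hf, ?_⟩
  rwa [h3 y hf, natCast_le_mul_add_iff] at hle

theorem InAOC.adviceB_le_of_minimize (hg : P.goal = .minimize) (h : P.InAOC) {a : ℕ}
    (H : HardFamily P a) (α : ℝ) :
    ∃ K : ℝ, ∀ c : ℕ → ℝ, (∀ n, 1 < c n) → ∀ A : AdviceAlgorithm P, A.IsCompetitiveWith c α →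
      ∀ n b : ℕ, A.ReadsAtMost n b →
        adviceB n (c n) - K * Real.logb 2 (n + 1) ≤ (b : ℝ) := by
  obtain ⟨α', hα⟩ := exists_nat_ge α
  -- Excess ones: α' for the additive constant, 1 for the exceptional position, a for the shift from
  -- weight t to t + a.
  set D := α' + 1 + a with hD
  have hD0 : 0 ≤ (D : ℝ) * (1 + Real.logb 2 (D + 1)) :=
    mul_nonneg (Nat.cast_nonneg D)
      (add_nonneg zero_le_one (Real.logb_nonneg one_lt_two (by simp)))
  refine ⟨(a + 1 : ℕ) + 1 + D * (1 + Real.logb 2 (D + 1)), fun c hc A hA N b hb => ?_⟩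
  rcases Nat.eq_zero_or_pos N with rfl | hN
  · simp [adviceB]
  have hlog := logb_two_succ_ge_one hN
  -- The family has no instance with fewer than a requests, but there B is at most N and hence
  -- bounded.
  rcases lt_or_ge N a with hNa | hNa
  · have h1 := adviceB_le (hc N) N
    have h2 : (N : ℝ) ≤ a := by exact_mod_cast hNa.le
    have h3 : (0 : ℝ) ≤ b := Nat.cast_nonneg b
    have h4 := mul_le_mul_of_nonneg_left hlog
      (by positivity : (0 : ℝ) ≤ (a + 1 : ℕ) + 1 + D * (1 + Real.logb 2 (D + 1)))
    push_cast at h4 ⊢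
    linarith
  obtain ⟨n, rfl⟩ : ∃ n, N = n + a := ⟨N - a, by omega⟩
  set C := c (n + a) with hC
  have hC1 : 1 < C := hc _
  obtain ⟨s, hs, hfin⟩ := exists_choose_adviceB_le (a + 1) D hC1 hN
  refine hfin b ?_
  have hsf : s ≤ ⌊C * s⌋₊ := Nat.le_floor (by nlinarith [Nat.cast_nonneg (α := ℝ) s])
  -- For s < a the binomial coefficient is polynomial in N and no hard instance is needed.
  rcases lt_or_ge s a with hsa | hsa
  · have h1 : 1 ≤ (⌊C * s⌋₊ + D).choose s := Nat.choose_pos (by omega)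
    calc (n + a).choose s ≤ (n + a) ^ s := Nat.choose_le_pow _ _
      _ ≤ (n + a + 1) ^ s := Nat.pow_le_pow_left (Nat.le_succ _) s
      _ ≤ (n + a + 1) ^ (a + 1) := Nat.pow_le_pow_right (by omega) (by omega)
      _ = 1 * (n + a + 1) ^ (a + 1) * 1 := by ring
      _ ≤ _ := by
        gcongr
        exact Nat.one_le_two_pow
  · obtain ⟨t, rfl⟩ : ∃ t, s = t + a := ⟨s - a, by omega⟩
    choose pos y hrun hy using fun x => hA (H.inst n x)
    have hcount := H.choose_le (t := t) (k := ⌊C * (t + a : ℕ)⌋₊ + α') hb pos y hrun (by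
      intro x hx
      obtain ⟨z, hz, hzle⟩ := H.exists_output n x
      obtain ⟨h1, h2⟩ := Bounded.of_minimize hg h (hc _) (hy x) hz
      refine ⟨h1, ?_⟩
      have hlen : c (P.length (H.inst n x)) = C := by rw [H.length_inst]
      rw [hlen] at h2
      rw [← Nat.floor_add_natCast (by positivity)]
      refine Nat.le_floor (h2.trans ?_)
      rw [hx] at hzle
      have h3 : (numOnes z : ℝ) ≤ (t + a : ℕ) := by exact_mod_cast hzle
      gcongr)
    calc (n + a).choose (t + a) ≤ (n + a + 1) ^ a * n.choose t := choose_add_add_le n t a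
      _ ≤ (n + a + 1) ^ a * (2 ^ b * (n + 1) * (⌊C * (t + a : ℕ)⌋₊ + α' + 1).choose t) := by
        gcongr
      _ ≤ (n + a + 1) ^ a * (2 ^ b * (n + a + 1) *
          (⌊C * (t + a : ℕ)⌋₊ + D).choose (t + a)) := by
        gcongr
        · omega
        · exact (choose_le_choose_add_add _ t a).trans_eq (by rw [hD]; congr 1; omega)
      _ = _ := by rw [pow_succ]; ring

theorem InAOC.adviceB_le_of_maximize (hg : P.goal = .maximize) (h : P.InAOC)
    (H : HardFamily P 0) (α : ℝ) :
    ∃ K : ℝ, ∀ c : ℕ → ℝ, (∀ n, 1 < c n) → ∀ A : AdviceAlgorithm P, A.IsCompetitiveWith c α →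
      ∀ n b : ℕ, A.ReadsAtMost n b →
        adviceB n (c n) - K * Real.logb 2 (n + 1) ≤ (b : ℝ) := by
  obtain ⟨α', hα⟩ := exists_nat_ge α
  refine ⟨(1 : ℕ) + 1 + (α' + 1 : ℕ) * (1 + Real.logb 2 ((α' + 1 : ℕ) + 1)),
    fun c hc A hA n b hb => ?_⟩
  rcases Nat.eq_zero_or_pos n with rfl | hN
  · simp [adviceB]
  set C := c n with hC
  have hC1 : 1 < C := hc _
  have hC0 : 0 < C := by linarith
  obtain ⟨s, hs, hfin⟩ := exists_choose_adviceB_le 1 (α' + 1) hC1 hN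
  refine hfin b ?_
  have hsf : s ≤ ⌊C * s⌋₊ := Nat.le_floor (by nlinarith [Nat.cast_nonneg (α := ℝ) s])
  -- Since u > C * s + α, an optimum of at least u forces the algorithm to accept more than s
  -- requests. The strict inequality absorbs the exceptional position.
  obtain ⟨u, hu⟩ : ∃ u, u = ⌊C * s⌋₊ + (α' + 1) := ⟨_, rfl⟩
  rw [← hu, pow_one]
  rcases lt_or_ge n u with hnu | hun
  · calc n.choose s ≤ u.choose s := Nat.choose_le_choose s hnu.le
      _ ≤ _ := Nat.le_mul_of_pos_left _ (by positivity)
  · choose pos y hrun hy using fun x => hA (H.inst n x)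
    have hcount := H.choose_le (t := n - u) (k := n - s - 1) hb pos y hrun (by
      intro x hx
      obtain ⟨z, hz, hzle⟩ := H.exists_output n x
      obtain ⟨h1, h2⟩ := Bounded.of_maximize hg h (hc _) (hy x) hz
      refine ⟨h1, ?_⟩
      have hlen := H.length_inst n x
      have hz' := numOnes_add_numZeros z
      have hy' := numOnes_add_numZeros (y x)
      have hcC : c (P.length (H.inst n x)) = C := by rw [hlen]; rfl
      rw [hcC] at h2
      have hzu : (u : ℝ) ≤ numZeros z := by exact_mod_cast (by omega : u ≤ numZeros z)
      have hfl := Nat.lt_floor_add_one (C * s)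
      rw [hu] at hzu
      push_cast at hzu
      have h3 : C * s < C * numZeros (y x) := by linarith
      have h4 : s < numZeros (y x) := by exact_mod_cast lt_of_mul_lt_mul_left h3 hC0.le
      omega)
    rw [show n - s - 1 + 1 = n - s by omega] at hcount
    -- Choosing s of u among n in either order converts the ratio C(n,n-u)/C(n-s,n-u) into
    -- C(n,s)/C(u,s).
    have ha := Nat.choose_mul (n := n) (k := u) (s := s) (by omega)
    rw [← Nat.choose_symm (by omega : u ≤ n),
      ← Nat.choose_symm (by omega : u - s ≤ n - s),
      show n - s - (u - s) = n - u by omega] at ha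
    have hpos : 0 < (n - s).choose (n - u) := Nat.choose_pos (by omega)
    refine Nat.le_of_mul_le_mul_right ?_ hpos
    rw [← ha]
    calc n.choose (n - u) * u.choose s
        ≤ 2 ^ b * (n + 1) * (n - s).choose (n - u) * u.choose s := by gcongr
      _ = _ := by ring

end OnlineProblem

/-! ### Membership in AOC -/

namespace OnlineProblem

variable {P : OnlineProblem}

lemma feasible_iff_of_costOf {I : P.Input} {y : Fin (P.length I) → Bool} {F : Prop}
    (h : P.score I y = costOf F (numOnes y)) : P.Feasible I y ↔ F := by
  rw [Feasible, h, costOf]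
  split_ifs with hF
  · exact ⟨fun _ => hF, fun _ => ⟨_, rfl⟩⟩
  · exact ⟨fun ⟨k, hk⟩ => absurd hk.symm (EReal.natCast_ne_top k), fun h => absurd h hF⟩

lemma feasible_iff_of_profitOf {I : P.Input} {y : Fin (P.length I) → Bool} {F : Prop}
    (h : P.score I y = profitOf F (numZeros y)) : P.Feasible I y ↔ F := by
  rw [Feasible, h, profitOf]
  split_ifs with hF
  · exact ⟨fun _ => hF, fun _ => ⟨_, rfl⟩⟩
  · exact ⟨fun ⟨k, hk⟩ => absurd hk.symm (EReal.natCast_ne_bot k), fun h => absurd h hF⟩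

/-- Feasibility is upward closed here, which is more than AOC asks for. An optimal output is
feasible because the all-ones output is. -/
lemma inAOC_of_costOf (hg : P.goal = .minimize) (F : ∀ I, (Fin (P.length I) → Bool) → Prop)
    (hs : ∀ I y, P.score I y = costOf (F I y) (numOnes y)) (htrue : ∀ I, F I fun _ => true)
    (hmono : ∀ I y y', F I y' → (∀ i, y' i = true → y i = true) → F I y) : P.InAOC := by
  simp only [InAOC, hg]
  intro I
  have hf : ∀ y, P.Feasible I y ↔ F I y := fun y => feasible_iff_of_costOf (hs I y)
  refine ⟨fun y => ?_, ⟨_, (hf _).2 (htrue I)⟩, fun y hy => ?_, fun y y' hopt hle => ?_⟩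
  · rw [hf, hs, costOf]
    split_ifs with h <;> simp [h]
  · rw [hs, costOf, if_pos ((hf y).1 hy)]
  · rw [hf]
    refine hmono I y y' ?_ hle
    by_contra hno
    have h1 := hopt fun _ => true
    rw [hs, hs, costOf, costOf, if_neg hno, if_pos (htrue I), top_le_iff] at h1
    exact EReal.natCast_ne_top _ h1

lemma inAOC_of_profitOf (hg : P.goal = .maximize) (F : ∀ I, (Fin (P.length I) → Bool) → Prop)
    (hs : ∀ I y, P.score I y = profitOf (F I y) (numZeros y)) (htrue : ∀ I, F I fun _ => true)
    (hmono : ∀ I y y', F I y' → (∀ i, y' i = true → y i = true) → F I y) : P.InAOC := by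
  simp only [InAOC, hg]
  intro I
  have hf : ∀ y, P.Feasible I y ↔ F I y := fun y => feasible_iff_of_profitOf (hs I y)
  refine ⟨fun y => ?_, ⟨_, (hf _).2 (htrue I)⟩, fun y hy => ?_, fun y y' hopt hle => ?_⟩
  · rw [hf, hs, profitOf]
    split_ifs with h <;> simp [h]
  · rw [hs, profitOf, if_pos ((hf y).1 hy)]
  · rw [hf]
    refine hmono I y y' ?_ hle
    by_contra hno
    have h1 := hopt fun _ => true
    rw [hs, hs, profitOf, profitOf, if_neg hno, if_pos (htrue I), le_bot_iff] at h1
    exact EReal.natCast_ne_bot _ h1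

end OnlineProblem

open OnlineProblem

theorem onlineVertexCover_inAOC : onlineVertexCover.InAOC :=
  inAOC_of_costOf rfl (fun I y => I.2.IsVertexCover {v | y v = true}) (fun _ _ => rfl)
    (fun _ _ _ _ => Or.inl rfl) fun _ _ _ h hle _ _ hadj => (h hadj).imp (hle _) (hle _)

theorem onlineIndependentSet_inAOC : onlineIndependentSet.InAOC :=
  inAOC_of_profitOf rfl (fun I y => I.2.IsIndepSet {v | y v = false}) (fun _ _ => rfl)
    (fun _ _ h => Bool.noConfusion h) fun _ y y' h hle => h.mono fun v hv => by
      have hv' : y v = false := hv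
      have := hle v
      rcases hy : y' v with _ | _
      · exact hy
      · rw [this hy] at hv'; cases hv'

theorem onlineDominatingSet_inAOC : onlineDominatingSet.InAOC :=
  inAOC_of_costOf rfl (fun I y => ∀ v, y v = true ∨ ∃ u, y u = true ∧ I.2.Adj u v)
    (fun _ _ => rfl) (fun _ _ => Or.inl rfl)
    fun _ _ _ h hle v => (h v).imp (hle v) fun ⟨u, hu, hadj⟩ => ⟨u, hle u hu, hadj⟩

lemma biUnion_sets_eq_ground_iff (I : SetCoverInput) (y : Fin I.n → Bool) :
    (Finset.univ.filter fun i => y i = true).biUnion I.sets = I.ground ↔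
      ∀ k ∈ I.ground, ∃ i, y i = true ∧ k ∈ I.sets i := by
  constructor
  · intro h k hk
    rw [← h] at hk
    simpa using hk
  · intro h
    refine subset_antisymm ?_ fun k hk => by simpa using h k hk
    rw [← I.union_eq]
    exact Finset.biUnion_subset_biUnion_of_subset_left _ (Finset.subset_univ _)

theorem onlineSetCover_inAOC : onlineSetCover.InAOC :=
  inAOC_of_costOf rfl (fun I y => ∀ k ∈ I.ground, ∃ i, y i = true ∧ k ∈ I.sets i)
    (fun I y => congrArg (fun F => costOf F (numOnes y))
      (propext (biUnion_sets_eq_ground_iff I y)))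
    (fun I k hk => by
      rw [← I.union_eq, Finset.mem_biUnion] at hk
      obtain ⟨i, -, hi⟩ := hk
      exact ⟨i, rfl, hi⟩)
    fun _ _ _ h hle k hk => (h k hk).imp fun i hi => ⟨hle i hi.1, hi.2⟩

theorem onlineDisjointPathAllocation_inAOC : onlineDisjointPathAllocation.InAOC :=
  inAOC_of_profitOf rfl (fun I y =>
      {i | y i = false}.PairwiseDisjoint fun i => Set.Ico (I.path i).1 (I.path i).2)
    (fun _ _ => rfl) (fun _ _ h => Bool.noConfusion h) fun _ y y' h hle => h.subset fun v hv => by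
      have hv' : y v = false := hv
      have := hle v
      rcases hy : y' v with _ | _
      · exact hy
      · rw [this hy] at hv'; cases hv'

theorem onlineCycleFinding_inAOC : onlineCycleFinding.InAOC :=
  inAOC_of_costOf rfl (fun I y => ¬ (I.1.2.induce {v | y v = true}).IsAcyclic) (fun _ _ => rfl)
    (fun I h => I.2 (h.comap (G := I.1.2) ⟨fun v => ⟨v, rfl⟩, fun hadj => hadj⟩
      fun _ _ huv => congrArg Subtype.val huv))
    fun I _ _ h hle hac => h (hac.embedding (I.1.2.induceHomOfLE fun v hv => hle v hv))

/-! ### Hard instances: vertex cover and independent set -/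

/-- Two uncovered ones of x would violate the hypothesis for that pair. One exception cannot be
avoided: a vertex cover of a clique may omit a vertex. -/
lemma exists_forall_ne_of_forall_lt {n : ℕ} {x y : Fin n → Bool}
    (h : ∀ i j, i < j → x i = true → y i = true ∨ y j = true) :
    ∃ e : ℕ, ∀ i : Fin n, x i = true → (i : ℕ) ≠ e → y i = true := by
  by_cases hex : ∃ i, x i = true ∧ y i ≠ true
  · obtain ⟨i, hx, hy⟩ := hex
    refine ⟨i, fun j hj hne => ?_⟩
    rcases lt_or_gt_of_ne hne with hlt | hlt
    · exact (h j i hlt hj).resolve_right hy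
    · exact (h i j hlt hx).resolve_left hy
  · push Not at hex
    exact ⟨0, fun i hi _ => hex i hi⟩

/-- The graph in which a vertex `i` with `x i = true` is joined to all later vertices. -/
def laterGraph {n : ℕ} (x : Fin n → Bool) : SimpleGraph (Fin n) where
  Adj i j := (i < j ∧ x i = true) ∨ (j < i ∧ x j = true)
  symm := ⟨fun _ _ h => h.symm⟩
  loopless := ⟨fun i h => by simp at h⟩

lemma laterGraph_adj {n : ℕ} (x : Fin n → Bool) {i j : Fin n} (h : i < j) :
    (laterGraph x).Adj i j ↔ x i = true := by
  simp [laterGraph, h, h.le]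

lemma vertexArrival_laterGraph {n : ℕ} {x x' : Fin n → Bool} {i : Fin n}
    (h : ∀ j < i, x j = x' j) :
    vertexArrival (laterGraph x) i = vertexArrival (laterGraph x') i := by
  ext k
  refine exists_congr fun j => and_congr_right fun _ => and_congr_right fun hj => ?_
  rw [laterGraph_adj x hj, laterGraph_adj x' hj, h j hj]

lemma isVertexCover_laterGraph {n : ℕ} (x y : Fin n → Bool) :
    (laterGraph x).IsVertexCover {v | y v = true} ↔
      ∀ i j, i < j → x i = true → y i = true ∨ y j = true := by
  constructor
  · exact fun h i j hij hx => h ((laterGraph_adj x hij).2 hx)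
  · rintro h i j (⟨hij, hx⟩ | ⟨hij, hx⟩)
    · exact h i j hij hx
    · exact (h j i hij hx).symm

/-- The hard instances of online vertex cover. -/
def hardVertexCover : HardFamily onlineVertexCover 0 where
  inst n x := ⟨n, laterGraph x⟩
  length_inst _ _ := rfl
  init_inst _ _ _ := rfl
  request_inst _ _ _ _ h := vertexArrival_laterGraph h
  exists_output _ x := ⟨x, (feasible_iff_of_costOf rfl).2
    ((isVertexCover_laterGraph x x).2 fun _ _ _ h => Or.inl h), le_rfl⟩
  covers _ x y hy := exists_forall_ne_of_forall_lt
    ((isVertexCover_laterGraph x y).1 ((feasible_iff_of_costOf rfl).1 hy))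

lemma isIndepSet_laterGraph {n : ℕ} (x y : Fin n → Bool) :
    (laterGraph x).IsIndepSet {v | y v = false} ↔
      ∀ i j, i < j → x i = true → y i = true ∨ y j = true := by
  rw [← isVertexCover_laterGraph, ← SimpleGraph.isIndepSet_compl_iff_isVertexCover]
  congr! 2
  ext v
  simp

/-- The hard instances of online independent set. -/
def hardIndependentSet : HardFamily onlineIndependentSet 0 where
  inst n x := ⟨n, laterGraph x⟩
  length_inst _ _ := rfl
  init_inst _ _ _ := rfl
  request_inst _ _ _ _ h := vertexArrival_laterGraph h
  exists_output _ x := ⟨x, (feasible_iff_of_profitOf rfl).2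
    ((isIndepSet_laterGraph x x).2 fun _ _ _ h => Or.inl h), le_rfl⟩
  covers _ x y hy := exists_forall_ne_of_forall_lt
    ((isIndepSet_laterGraph x y).1 ((feasible_iff_of_profitOf rfl).1 hy))

/-! ### Hard instances: disjoint path allocation -/

/-- The left end of the interval that contains all requests from number `i` on: of the two halves
of the previous interval, it is the left one if `x` has a one, and the right one otherwise. -/
def bisectStart {n : ℕ} (x : Fin n → Bool) : ℕ → ℕ
  | 0 => 0
  | i + 1 => bisectStart x i +
      if h : i < n then (if x ⟨i, h⟩ = true then 0 else 2 ^ (n - (i + 1))) else 0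

lemma bisectStart_congr {n : ℕ} {x x' : Fin n → Bool} {i : ℕ}
    (h : ∀ j : Fin n, (j : ℕ) < i → x j = x' j) : bisectStart x i = bisectStart x' i := by
  induction i with
  | zero => rfl
  | succ i ih =>
    rw [bisectStart, bisectStart, ih fun j hj => h j (by omega)]
    congr 1
    by_cases hi : i < n
    · rw [dif_pos hi, dif_pos hi, h ⟨i, hi⟩ (Nat.lt_succ_self i)]
    · rw [dif_neg hi, dif_neg hi]

lemma bisectStart_nested {n : ℕ} (x : Fin n → Bool) {i j : ℕ} (hij : i ≤ j) (hj : j ≤ n) :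
    bisectStart x i ≤ bisectStart x j ∧
      bisectStart x j + 2 ^ (n - j) ≤ bisectStart x i + 2 ^ (n - i) := by
  induction j, hij using Nat.le_induction with
  | base => exact ⟨le_rfl, le_rfl⟩
  | succ j hij ih =>
    obtain ⟨h1, h2⟩ := ih (by omega)
    have h3 : 2 ^ (n - j) = 2 * 2 ^ (n - (j + 1)) := by
      rw [← pow_succ']; congr 1; omega
    rw [bisectStart, dif_pos (by omega : j < n)]
    split_ifs <;> omega

/-- The instance of disjoint path allocation with requests chosen by bisection. -/
def bisectInput (n : ℕ) (x : Fin n → Bool) : PathInput where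
  L := 2 ^ n
  n := n
  path i := (bisectStart x i, bisectStart x i + 2 ^ (n - (i + 1)))
  lt i := Nat.lt_add_of_pos_right (by positivity)
  le i := by
    have h := (bisectStart_nested x (Nat.zero_le i) i.2.le).2
    have h1 : 2 ^ (n - ((i : ℕ) + 1)) ≤ 2 ^ (n - (i : ℕ)) := Nat.pow_le_pow_right two_pos (by omega)
    simp only [bisectStart, Nat.sub_zero] at h
    simp only
    omega

/-- Request i is the left half of the current interval. All later requests stay in that half, and so
meet request i, if x i is one; otherwise they lie in the right half. The conflicts are those of
`laterGraph`. -/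
lemma pairwiseDisjoint_bisectInput {n : ℕ} (x y : Fin n → Bool) :
    ({i | y i = false}.PairwiseDisjoint fun i =>
      Set.Ico ((bisectInput n x).path i).1 ((bisectInput n x).path i).2) ↔
      ∀ i j, i < j → x i = true → y i = true ∨ y j = true := by
  have hdisj : ∀ i j : Fin n, i < j →
      (Disjoint (Set.Ico ((bisectInput n x).path i).1 ((bisectInput n x).path i).2)
        (Set.Ico ((bisectInput n x).path j).1 ((bisectInput n x).path j).2) ↔ x i = false) := by
    intro i j hij
    have hij' : (i : ℕ) + 1 ≤ j := hij
    obtain ⟨h1, h2⟩ := bisectStart_nested x hij' j.2.le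
    have h3 : 2 ^ (n - (j : ℕ)) = 2 * 2 ^ (n - ((j : ℕ) + 1)) := by
      rw [← pow_succ']; congr 1; omega
    have h4 : 0 < 2 ^ (n - ((j : ℕ) + 1)) := by positivity
    simp only [bisectStart, dif_pos i.2, Fin.eta] at h1 h2
    simp only [bisectInput, Set.Ico_disjoint_Ico]
    rcases hx : x i with _ | _ <;> simp only [hx] at h1 h2 <;> simp at h1 h2 ⊢ <;> omega
  constructor
  · intro h i j hij hx
    by_contra! hno
    have := (hdisj i j hij).1 (h (by simpa using hno.1) (by simpa using hno.2) hij.ne)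
    rw [hx] at this; cases this
  · intro h i hi j hj hne
    have hi' : y i = false := hi
    have hj' : y j = false := hj
    rcases lt_or_gt_of_ne hne with hlt | hlt
    · refine (hdisj i j hlt).2 ?_
      have := h i j hlt
      simpa [hi', hj'] using this
    · refine ((hdisj j i hlt).2 ?_).symm
      have := h j i hlt
      simpa [hi', hj'] using this

/-- The hard instances of online disjoint path allocation. -/
def hardDisjointPathAllocation : HardFamily onlineDisjointPathAllocation 0 where
  inst := bisectInput
  length_inst _ _ := rfl
  init_inst _ _ _ := rfl
  request_inst n x x' i h := by
    have h1 : bisectStart x i = bisectStart x' i := bisectStart_congr h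
    change ((bisectStart x i, bisectStart x i + 2 ^ (n - ((i : ℕ) + 1))) : ℕ × ℕ) =
      (bisectStart x' i, bisectStart x' i + 2 ^ (n - ((i : ℕ) + 1)))
    rw [h1]
  exists_output _ x := ⟨x, (feasible_iff_of_profitOf rfl).2
    ((pairwiseDisjoint_bisectInput x x).2 fun _ _ _ h => Or.inl h), le_rfl⟩
  covers _ x y hy := exists_forall_ne_of_forall_lt
    ((pairwiseDisjoint_bisectInput x y).1 ((feasible_iff_of_profitOf rfl).1 hy))

/-! ### Hard instances: dominating set and set cover -/

/-- The bit string `x`, followed by ones. -/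
def padOnes {n : ℕ} (x : Fin n → Bool) (i : ℕ) : Bool := if h : i < n then x ⟨i, h⟩ else true

lemma padOnes_val {n : ℕ} (x : Fin n → Bool) (i : Fin n) : padOnes x i = x i := by
  simp [padOnes]

lemma padOnes_of_le {n : ℕ} (x : Fin n → Bool) {i : ℕ} (h : n ≤ i) : padOnes x i = true := by
  simp [padOnes, h]

lemma numOnes_padOnes_le {n : ℕ} (x : Fin n → Bool) (a : ℕ) :
    numOnes (fun i : Fin (n + a) => padOnes x i) ≤ numOnes x + a := by
  simp only [numOnes, Finset.card_filter]
  rw [Fin.sum_univ_add]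
  refine add_le_add (le_of_eq (Finset.sum_congr rfl fun i _ => ?_)) ?_
  · rw [Fin.val_castAdd, padOnes_val]
  · refine (Finset.sum_le_card_nsmul _ _ 1 fun i _ => ?_).trans (by simp)
    split_ifs <;> simp

/-- The graph in which the last vertex is joined to the vertices `i` with `x i = false`, and which
has no other edges. -/
def lastGraph {n : ℕ} (x : Fin n → Bool) : SimpleGraph (Fin (n + 1)) where
  Adj i j := (padOnes x i = false ∧ (j : ℕ) = n) ∨ (padOnes x j = false ∧ (i : ℕ) = n)
  symm := ⟨fun _ _ h => h.symm⟩
  loopless := ⟨fun i h => by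
    rcases h with ⟨h, hi⟩ | ⟨h, hi⟩ <;> simp [padOnes_of_le x hi.ge] at h⟩

/-- The hard instances of online dominating set. -/
def hardDominatingSet : HardFamily onlineDominatingSet 1 where
  inst n x := ⟨n + 1, lastGraph x⟩
  length_inst _ _ := rfl
  init_inst _ _ _ := rfl
  request_inst n x x' i _ := by
    -- The first n vertices arrive without edges and reveal nothing about x.
    have h : ∀ z : Fin n → Bool, vertexArrival (lastGraph z) i.castSucc = ∅ := by
      intro z
      rw [Set.eq_empty_iff_forall_notMem]
      rintro k ⟨j, -, hj, hadj⟩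
      have hj' : (j : ℕ) < i := hj
      rcases hadj with ⟨-, h⟩ | ⟨-, h⟩
      · have : (i : ℕ) = n := h
        omega
      · omega
    exact (h x).trans (h x').symm
  exists_output n x := by
    refine ⟨fun i => padOnes x i, (feasible_iff_of_costOf rfl).2 fun v => ?_,
      numOnes_padOnes_le x 1⟩
    rcases hv : padOnes x v with _ | _
    · exact Or.inr ⟨Fin.last n, padOnes_of_le x le_rfl, Or.inr ⟨hv, rfl⟩⟩
    · exact Or.inl hv
  covers n x y hy := by
    -- No exception is needed, so e lies out of range. The ones of x are isolated vertices and can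
    -- only dominate themselves.
    refine ⟨n, fun i hi _ => ?_⟩
    rcases (feasible_iff_of_costOf rfl).1 hy i.castSucc with h | ⟨u, -, ⟨-, h⟩ | ⟨h, -⟩⟩
    · exact h
    · have : (i : ℕ) = n := h
      omega
    · have h' : padOnes x i = false := h
      rw [padOnes_val, hi] at h'; cases h'

/-- The instance of set cover with singletons and a final set that contains the elements `i` with
`x i = false`. -/
def singletonInput (n : ℕ) (x : Fin n → Bool) : SetCoverInput where
  -- The universe is known from the beginning, so it must not depend on x.
  ground := Finset.range (n + 1)
  n := n + 1
  sets i := if (i : ℕ) < n then {(i : ℕ)} else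
    (Finset.range (n + 1)).filter fun k => padOnes x k = false ∨ k = n
  union_eq := by
    ext k
    simp only [Finset.mem_biUnion, Finset.mem_univ, true_and, Finset.mem_range]
    constructor
    · rintro ⟨i, hi⟩
      split_ifs at hi with h
      · rw [Finset.mem_singleton] at hi; omega
      · exact Finset.mem_range.1 (Finset.mem_filter.1 hi).1
    · intro hk
      refine ⟨⟨k, hk⟩, ?_⟩
      split_ifs with h
      · simp
      · simp only [Finset.mem_filter, Finset.mem_range]
        have : k = n := by simp at h; omega
        exact ⟨hk, Or.inr this⟩

/-- The hard instances of online set cover. -/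
def hardSetCover : HardFamily onlineSetCover 1 where
  inst := singletonInput
  length_inst _ _ := rfl
  init_inst _ _ _ := rfl
  request_inst n x x' i _ := by
    have h : ∀ z, (singletonInput n z).sets i.castSucc = {(i : ℕ)} := by
      intro z; simp [singletonInput]
    exact (h x).trans (h x').symm
  exists_output n x := by
    refine ⟨fun i => padOnes x i, (feasible_iff_of_costOf rfl).2
      ((biUnion_sets_eq_ground_iff _ _).2 fun k hk => ?_), numOnes_padOnes_le x 1⟩
    have hk' : k < n + 1 := Finset.mem_range.1 hk
    by_cases h : padOnes x k = true ∧ k < n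
    · refine ⟨⟨k, hk'⟩, h.1, ?_⟩
      simp [singletonInput, h.2]
    · refine ⟨Fin.last n, padOnes_of_le x le_rfl, ?_⟩
      simp only [singletonInput, Fin.val_last, lt_irrefl, if_false, Finset.mem_filter]
      refine ⟨hk, ?_⟩
      rcases hp : padOnes x k with _ | _
      · exact Or.inl rfl
      · refine Or.inr ?_
        by_contra hne
        exact h ⟨hp, by omega⟩
  covers n x y hy := by
    refine ⟨n, fun i hi _ => ?_⟩
    obtain ⟨j, hj, hij⟩ := (biUnion_sets_eq_ground_iff (singletonInput n x) y).1
      ((feasible_iff_of_costOf rfl).1 hy) i (Finset.mem_range.2 (by omega))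
    simp only [singletonInput] at hij
    split_ifs at hij with h
    · rw [Finset.mem_singleton] at hij
      rw [← hj]
      exact congrArg y (Fin.ext hij)
    · have h3 := (Finset.mem_filter.1 hij).2
      rw [padOnes_val, hi] at h3
      rcases h3 with h3 | h3
      · cases h3
      · omega

/-! ### Hard instances: cycle finding -/

/-- The graph in which a vertex is joined to the latest earlier vertex `i` with `padOnes x i = true`,
and the last vertex is joined to the first such vertex as well. -/
def closedPathGraph {n : ℕ} (x : Fin n → Bool) : SimpleGraph (Fin (n + 3)) :=
  SimpleGraph.fromRel fun i j => i < j ∧ padOnes x i = true ∧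
    ((∀ k : ℕ, i < k → k < j → padOnes x k = false) ∨
      ((j : ℕ) = n + 2 ∧ ∀ k : ℕ, k < i → padOnes x k = false))

lemma closedPathGraph_adj {n : ℕ} (x : Fin n → Bool) {i j : Fin (n + 3)} (h : i < j) :
    (closedPathGraph x).Adj i j ↔ padOnes x i = true ∧
      ((∀ k : ℕ, i < k → k < j → padOnes x k = false) ∨
        ((j : ℕ) = n + 2 ∧ ∀ k : ℕ, k < i → padOnes x k = false)) := by
  simp [closedPathGraph, h, h.ne, not_lt_of_ge h.le]

/-- The vertex set of a cycle has minimum degree two, which allows arguments with extremal vertices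
instead of walks. -/
lemma exists_two_neighbors_of_not_isAcyclic {V : Type*} {G : SimpleGraph V} {s : Set V}
    (h : ¬ (G.induce s).IsAcyclic) :
    ∃ S ⊆ s, S.Nonempty ∧ ∀ v ∈ S, ∃ u ∈ S, ∃ w ∈ S, u ≠ w ∧ G.Adj v u ∧ G.Adj v w := by
  simp only [SimpleGraph.IsAcyclic, not_forall, not_not] at h
  obtain ⟨v, p, hp⟩ := h
  refine ⟨Subtype.val '' {u | u ∈ p.support}, ?_, ⟨v, v, p.start_mem_support, rfl⟩, ?_⟩
  · rintro _ ⟨u, -, rfl⟩; exact u.2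
  · rintro _ ⟨z, hz, rfl⟩
    obtain ⟨u, w, huw, heq⟩ := Set.ncard_eq_two.1 (hp.ncard_neighborSet_toSubgraph_eq_two hz)
    have hu : p.toSubgraph.Adj z u := by
      have : u ∈ p.toSubgraph.neighborSet z := by rw [heq]; simp
      exact this
    have hw : p.toSubgraph.Adj z w := by
      have : w ∈ p.toSubgraph.neighborSet z := by rw [heq]; simp
      exact this
    exact ⟨u, ⟨u, by simpa using hu.snd_mem, rfl⟩, w, ⟨w, by simpa using hw.snd_mem, rfl⟩,
      fun h => huw (Subtype.ext h), hu.adj_sub, hw.adj_sub⟩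

lemma exists_latest_one {n : ℕ} (x : Fin n → Bool) {i v : ℕ} (hi : padOnes x i = true)
    (hiv : i < v) : ∃ p, i ≤ p ∧ p < v ∧ padOnes x p = true ∧
      ∀ k, p < k → k < v → padOnes x k = false := by
  induction v, hiv using Nat.le_induction with
  | base => exact ⟨i, le_rfl, Nat.lt_succ_self i, hi, fun k _ _ => by omega⟩
  | succ v hv ih =>
    rcases hx : padOnes x v with _ | _
    · obtain ⟨p, h1, h2, h3, h4⟩ := ih
      refine ⟨p, h1, by omega, h3, fun k hk1 hk2 => ?_⟩
      rcases Nat.lt_succ_iff_lt_or_eq.1 hk2 with h | rfl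
      · exact h4 k hk1 h
      · exact hx
    · exact ⟨v, by omega, Nat.lt_succ_self v, hx, fun k _ _ => by omega⟩

/-- Every cycle of `closedPathGraph x` contains all ones of `x`. -/
lemma padOnes_mem_of_not_isAcyclic {n : ℕ} (x : Fin n → Bool) {s : Set (Fin (n + 3))}
    (h : ¬ ((closedPathGraph x).induce s).IsAcyclic) (i : Fin (n + 3))
    (hi : padOnes x i = true) : i ∈ s := by
  obtain ⟨S, hSs, hne, hS⟩ := exists_two_neighbors_of_not_isAcyclic h
  refine hSs ?_
  have hlow : ∀ v u w : Fin (n + 3), (v : ℕ) ≠ n + 2 → u < v → w < v →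
      (closedPathGraph x).Adj v u → (closedPathGraph x).Adj v w → u = w := by
    intro v u w hv hu hw hau haw
    obtain ⟨hu1, hu2⟩ := (closedPathGraph_adj x hu).1 hau.symm
    obtain ⟨hw1, hw2⟩ := (closedPathGraph_adj x hw).1 haw.symm
    have hu3 := hu2.resolve_right fun h => hv h.1
    have hw3 := hw2.resolve_right fun h => hv h.1
    rcases lt_trichotomy u w with hlt | heq | hlt
    · rw [hu3 w hlt hw] at hw1; cases hw1
    · exact heq
    · rw [hw3 u hlt hu] at hu1; cases hu1
  -- A zero has no later neighbour and at most one earlier one, so it is not in S.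
  have hone : ∀ v ∈ S, padOnes x v = true := by
    intro v hv
    by_contra hv0
    have hvn : (v : ℕ) < n := by
      by_contra hge
      exact hv0 (padOnes_of_le x (by omega))
    obtain ⟨u, -, w, -, huw, hau, haw⟩ := hS v hv
    have hlt : ∀ u, (closedPathGraph x).Adj v u → u < v := by
      intro u hau
      rcases lt_or_gt_of_ne hau.ne with hlt | hlt
      · exact absurd ((closedPathGraph_adj x hlt).1 hau).1 hv0
      · exact hlt
    exact huw (hlow v u w (by omega) (hlt u hau) (hlt w haw) hau haw)
  -- The largest vertex of S has two earlier neighbours, which only the last vertex can have.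
  have hlast : Fin.last (n + 2) ∈ S := by
    obtain ⟨m, hm, hmax⟩ := S.toFinite.exists_maximal hne
    obtain ⟨u, hu, w, hw, huw, hau, haw⟩ := hS m hm
    have hlt : ∀ u ∈ S, (closedPathGraph x).Adj m u → u < m := by
      intro u hu hau
      rcases lt_or_gt_of_ne hau.ne with hlt | hlt
      · exact absurd (hmax hu hlt.le) (not_le_of_gt hlt)
      · exact hlt
    have hm' : (m : ℕ) = n + 2 := by
      by_contra hm'
      exact huw (hlow m u w hm' (hlt u hu hau) (hlt w hw haw) hau haw)
    rwa [← show m = Fin.last (n + 2) from Fin.ext hm']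
  by_contra hiS
  -- Let p be the largest one missing from S and j the next one. Then j is in S but has lost its
  -- neighbour p, so at most one neighbour in S remains: the next one after j, or the first one if j
  -- is the last vertex.
  obtain ⟨p, ⟨hp1, hpS⟩, hpmax⟩ := (Set.toFinite {p : Fin (n + 3) | padOnes x p = true ∧
    p ∉ S}).exists_maximal ⟨i, hi, hiS⟩
  have hpmem : ∀ j, p < j → padOnes x j = true → j ∈ S := by
    intro j hj hj1
    by_contra hjS
    exact absurd (hpmax ⟨hj1, hjS⟩ hj.le) (not_le_of_gt hj)
  have hplast : p < Fin.last (n + 2) := by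
    refine lt_of_le_of_ne (Fin.le_last p) ?_
    rintro rfl
    exact hpS hlast
  obtain ⟨j, ⟨hj1, hpj⟩, hjmin⟩ := (Set.toFinite {j : Fin (n + 3) | padOnes x j = true ∧
    p < j}).exists_minimal ⟨Fin.last (n + 2), padOnes_of_le x (by simp), hplast⟩
  have hbetween : ∀ k : Fin (n + 3), p < k → k < j → padOnes x k ≠ true := by
    intro k hk1 hk2 hk3
    exact absurd (hjmin ⟨hk3, hk1⟩ hk2.le) (not_le_of_gt hk2)
  obtain ⟨u, hu, w, hw, huw, hau, haw⟩ := hS j (hpmem j hpj hj1)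
  have hbelow : ∀ u ∈ S, u < j → (closedPathGraph x).Adj j u →
      (j : ℕ) = n + 2 ∧ ∀ k : ℕ, k < u → padOnes x k = false := by
    intro u hu huj hadj
    obtain ⟨h1, h2⟩ := (closedPathGraph_adj x huj).1 hadj.symm
    refine h2.resolve_left fun h3 => ?_
    rcases lt_trichotomy u p with hlt | rfl | hlt
    · rw [h3 p hlt hpj] at hp1; cases hp1
    · exact hpS hu
    · exact hbetween u hlt huj h1
  have habove : ∀ u ∈ S, j < u → (closedPathGraph x).Adj j u →
      ∀ k : ℕ, j < k → k < u → padOnes x k = false := by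
    intro u _ hju hadj
    refine ((closedPathGraph_adj x hju).1 hadj).2.resolve_right fun h => ?_
    rw [h.2 p hpj] at hp1; cases hp1
  have huniq : ∀ u ∈ S, ∀ w ∈ S, u < w → (closedPathGraph x).Adj j u →
      (closedPathGraph x).Adj j w → False := by
    intro u hu w hw huw hau haw
    rcases lt_or_gt_of_ne hau.ne with hlt | hlt
    · have := habove w hw (hlt.trans huw) haw u hlt huw
      rw [hone u hu] at this; cases this
    · obtain ⟨hj, hfirst⟩ := hbelow u hu hlt hau
      have hwj : w < j := lt_of_le_of_ne (Fin.le_def.2 (by omega)) haw.ne'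
      have := (hbelow w hw hwj haw).2 u huw
      rw [hone u hu] at this; cases this
  rcases lt_or_gt_of_ne huw with hlt | hlt
  · exact huniq u hu w hw hlt hau haw
  · exact huniq w hw u hu hlt haw hau

/-- The edge from the first one to the last vertex is not a bridge, since the path through
consecutive ones joins its ends. -/
lemma not_isAcyclic_closedPathGraph {n : ℕ} (x : Fin n → Bool) :
    ¬ ((closedPathGraph x).induce {i : Fin (n + 3) | padOnes x i = true}).IsAcyclic := by
  intro hac
  have hex : ∃ f, padOnes x f = true := ⟨n, padOnes_of_le x le_rfl⟩
  obtain ⟨f, hf, hmin⟩ : ∃ f, padOnes x f = true ∧ ∀ k < f, padOnes x k = false :=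
    ⟨Nat.find hex, Nat.find_spec hex, fun k hk => by simpa using Nat.find_min hex hk⟩
  have hfn : f ≤ n := by
    by_contra hlt
    have := hmin n (by omega)
    rw [padOnes_of_le x le_rfl] at this; cases this
  set H := (closedPathGraph x).induce {i : Fin (n + 3) | padOnes x i = true} with hH
  let F : {i : Fin (n + 3) | padOnes x i = true} := ⟨⟨f, by omega⟩, hf⟩
  let L : {i : Fin (n + 3) | padOnes x i = true} := ⟨Fin.last (n + 2), padOnes_of_le x (by simp)⟩
  have hFL : H.Adj F L :=
    (closedPathGraph_adj x (i := F) (j := L) (Fin.lt_def.2 (by simp [F, L]; omega))).2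
      ⟨hf, Or.inr ⟨rfl, hmin⟩⟩
  have hbr := SimpleGraph.isAcyclic_iff_forall_adj_isBridge.1 hac hFL
  rw [SimpleGraph.isBridge_iff] at hbr
  apply hbr
  have hreach : ∀ (v : ℕ) (hv : v < n + 3) (hv1 : padOnes x v = true),
      (H.deleteEdges {s(F, L)}).Reachable F ⟨⟨v, hv⟩, hv1⟩ := by
    intro v
    induction v using Nat.strong_induction_on with
    | _ v ih =>
      intro hv hv1
      rcases lt_trichotomy v f with hlt | rfl | hlt
      · have := hmin v hlt
        rw [hv1] at this; cases this
      · rfl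
      · obtain ⟨p, hfp, hpv, hp1, hp2⟩ := exists_latest_one x hf hlt
        refine (ih p hpv (by omega) hp1).trans (SimpleGraph.Adj.reachable ?_)
        rw [SimpleGraph.deleteEdges_adj]
        refine ⟨(closedPathGraph_adj x (Fin.lt_def.2 hpv)).2 ⟨hp1, Or.inl hp2⟩, ?_⟩
        intro hmem
        rw [Set.mem_singleton_iff, Sym2.eq_iff] at hmem
        simp only [F, L, Subtype.mk.injEq, Fin.ext_iff, Fin.val_last] at hmem
        rcases hmem with ⟨h1, h2⟩ | ⟨h1, h2⟩
        -- The path never uses the closing edge, because n+1 is a one strictly between f ≤ n and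
        -- n+2. This is why three ones are appended.
        · have := hp2 (n + 1) (by omega) (by omega)
          rw [padOnes_of_le x (by omega)] at this; cases this
        · omega
  exact hreach (n + 2) (by omega) L.2

/-- The hard instances of online cycle finding. -/
def hardCycleFinding : HardFamily onlineCycleFinding 3 where
  inst n x := ⟨⟨n + 3, closedPathGraph x⟩,
    fun h => not_isAcyclic_closedPathGraph x (h.induce _)⟩
  length_inst _ _ := rfl
  init_inst _ _ _ := rfl
  request_inst n x x' i h := by
    have hp : ∀ k : ℕ, k < i → padOnes x k = padOnes x' k := by
      intro k hk
      rw [padOnes, padOnes, dif_pos (by omega), dif_pos (by omega), h ⟨k, by omega⟩ hk]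
    change vertexArrival (closedPathGraph x) (i.castAdd 3) =
      vertexArrival (closedPathGraph x') (i.castAdd 3)
    ext k
    refine exists_congr fun j => and_congr_right fun _ => and_congr_right fun hj => ?_
    have hj' : (j : ℕ) < i := hj
    rw [closedPathGraph_adj x hj, closedPathGraph_adj x' hj, hp j hj']
    refine and_congr_right fun _ => or_congr ?_ ?_
    · exact forall_congr' fun k => imp_congr_right fun _ => forall_congr' fun hk => by rw [hp k hk]
    -- The closing edge concerns only the last vertex, whereas i < n.
    · exact and_congr_right fun h => by simp at h; omega
  exists_output n x := ⟨fun i => padOnes x i,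
    (feasible_iff_of_costOf rfl).2 (not_isAcyclic_closedPathGraph x), numOnes_padOnes_le x 3⟩
  covers n x y hy := ⟨n, fun i hi _ => padOnes_mem_of_not_isAcyclic x
    ((feasible_iff_of_costOf rfl).1 hy) (i.castAdd 3) (by rw [Fin.val_castAdd, padOnes_val, hi])⟩

/-! ### The theorem for the six problems -/

theorem mainTheorem1 (P : OnlineProblem)
    (hP : P = onlineVertexCover ∨ P = onlineCycleFinding ∨ P = onlineDominatingSet ∨
      P = onlineSetCover ∨ P = onlineIndependentSet ∨ P = onlineDisjointPathAllocation) :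
    -- the problem belongs to the class AOC
    P.InAOC ∧
    -- sufficient, even for the strict competitive ratio
    (∃ K : ℝ, ∀ c : ℕ → ℝ, (∀ n, 1 < c n) →
      ∃ (A : AdviceAlgorithm P) (b : ℕ → ℕ),
        A.IsStrictlyCompetitive c ∧
        (∀ n, A.ReadsAtMost n (b n)) ∧
        ∀ n : ℕ, (b n : ℝ) ≤ adviceB n (c n) + K * Real.logb 2 (n + 1)) ∧
    -- necessary, even for the non-strict competitive ratio with any additive constant
    (∀ α : ℝ, ∃ K : ℝ, ∀ c : ℕ → ℝ, (∀ n, 1 < c n) →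
      ∀ A : AdviceAlgorithm P, A.IsCompetitiveWith c α →
        ∀ n b : ℕ, A.ReadsAtMost n b →
          adviceB n (c n) - K * Real.logb 2 (n + 1) ≤ (b : ℝ)) := by
  rcases hP with rfl | rfl | rfl | rfl | rfl | rfl
  · exact ⟨onlineVertexCover_inAOC, onlineVertexCover_inAOC.exists_strictlyCompetitive,
      onlineVertexCover_inAOC.adviceB_le_of_minimize rfl hardVertexCover⟩
  · exact ⟨onlineCycleFinding_inAOC, onlineCycleFinding_inAOC.exists_strictlyCompetitive,
      onlineCycleFinding_inAOC.adviceB_le_of_minimize rfl hardCycleFinding⟩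
  · exact ⟨onlineDominatingSet_inAOC, onlineDominatingSet_inAOC.exists_strictlyCompetitive,
      onlineDominatingSet_inAOC.adviceB_le_of_minimize rfl hardDominatingSet⟩
  · exact ⟨onlineSetCover_inAOC, onlineSetCover_inAOC.exists_strictlyCompetitive,
      onlineSetCover_inAOC.adviceB_le_of_minimize rfl hardSetCover⟩
  · exact ⟨onlineIndependentSet_inAOC, onlineIndependentSet_inAOC.exists_strictlyCompetitive,
      onlineIndependentSet_inAOC.adviceB_le_of_maximize rfl hardIndependentSet⟩
  · exact ⟨onlineDisjointPathAllocation_inAOC,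
      onlineDisjointPathAllocation_inAOC.exists_strictlyCompetitive,
      onlineDisjointPathAllocation_inAOC.adviceB_le_of_maximize rfl hardDisjointPathAllocation⟩
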